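/- **Conventions.** Rings are commutative with $1$. For a ring $R$ let $\Omega_R$ be the module of absolute ($\mathbb Z$-linear) Kähler differentials and $\mathsf T(R)=\mathrm{Sym}_R(\Omega_R)$, generated as a ring by the elements $a$ and $\mathsf d(a)$, $a\in R$. The category $\mathsf{CRING}^{op}$ carries a tangent structure with negatives $\mathbb T=(\mathsf T,\mathsf p,+,0,\ell,\mathsf c,-)$, written here through ring morphisms: $\mathsf T(f)(a)=f(a)$, $\mathsf T(f)(\mathsf d(a))=\mathsf d(f(a))$ for a ring morphism $f$; $\mathsf p_R:R\to\mathsf T(R)$, $\mathsf p_R(a)=a$; $+_R:\mathsf T(R)\to\mathsf T(R)\otimes_R\mathsf T(R)$, $a\mapsto a\otimes 1=1\otimes a$, $\mathsf d(a)\mapsto \mathsf d(a)\otimes1+1\otimes\mathsf d(a)$; $0_R:\mathsf T(R)\to R$, $a\mapsto a$, $\mathsf d(a)\mapsto 0$; $-_R:\mathsf T(R)\to\mathsf T(R)$, $a\mapsto a$, $\mathsf d(a)\mapsto-\mathsf d(a)$; and, with $\mathsf T^2(R)$ generated by $a,\mathsf d(a),\mathsf d'(a),\mathsf d'\mathsf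 d(a)$, the vertical lift $\ell_R:\mathsf T^2(R)\to\mathsf T(R)$, $a\mapsto a$, $\mathsf d(a)\mapsto0$, $\mathsf d'(a)\mapsto 0$, $\mathsf d'\mathsf d(a)\mapsto\mathsf d(a)$, and the canonical flip $\mathsf c_R:\mathsf T^2(R)\to\mathsf T^2(R)$, $a\mapsto a$, $\mathsf d(a)\mapsto\mathsf d'(a)$, $\mathsf d'(a)\mapsto\mathsf d(a)$, $\mathsf d'\mathsf d(a)\mapsto\mathsf d'\mathsf d(a)$. **Differential bundles.** In a category $\mathbb X$ with a tangent structure, a *differential bundle* over an object $A$ consists of maps $\mathsf q:E\to A$, $\sigma:E_2\to E$, $\mathsf z:A\to E$, $\lambda:E\to\mathsf T(E)$, where for every $n$ the pullback $E_n$ of $n$ copies of $\mathsf q$ exists and is preserved by every $\mathsf T^m$, such that: $(\mathsf q,\sigma,\mathsf z)$ is a commutative monoid in $\mathbb X/A$; $\lambda$ is additive in two ways, namely $\mathsf T(\mathsf q)\lambda=0_A\mathsf q$, $\mathsf T(\sigma)\langle\lambda\pi_1,\lambda\pi_2\rangle=\lambda\sigma$, $\lambda\mathsf z=\mathsf T(\mathsf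 z)0_A$, and $\mathsf p_E\lambda=\mathsf z\mathsf q$, $+_E\langle\lambda\pi_1,\lambda\pi_2\rangle=\lambda\sigma$, $\lambda\mathsf z=0_E\mathsf z$; $\mathsf T(\lambda)\lambda=\ell_E\lambda$; and the square with sides $\mu=\mathsf T(\sigma)\langle\lambda\pi_1,0_E\pi_2\rangle:E_2\to\mathsf T(E)$, $\mathsf q\pi_j:E_2\to A$, $\mathsf T(\mathsf q):\mathsf T(E)\to\mathsf T(A)$ and $0_A:A\to\mathsf T(A)$ is a pullback, preserved by every $\mathsf T^n$. A *differential bundle with negatives* has in addition a map $\iota:E\to E$ making $(\mathsf q,\sigma,\mathsf z,\iota)$ an abelian group in $\mathbb X/A$. A *morphism over $A$* from $(\mathsf q,\sigma,\mathsf z,\lambda)$ to $(\mathsf q',\sigma',\mathsf z',\lambda')$ is a map $f:E\to E'$ with $\mathsf q'f=\mathsf q$ and $\lambda'f=\mathsf T(f)\lambda$. For a ring $R$ let $\mathsf{DBUN}_{\mathbb T}[R]$ be the category of differential bundles with negatives over $R$ in $(\mathsf{CRING}^{op},\mathbb T)$ and morphisms over $R$ between them. **Theorem.** Let $R$ be a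 commutative ring. Then $\mathsf{MOD}_R^{op}\simeq\mathsf{DBUN}_{\mathbb T}[R]$, and the following two functors form such an equivalence (they are quasi-inverse to each other). * $\mathsf M_R:\mathsf{MOD}_R^{op}\to\mathsf{DBUN}_{\mathbb T}[R]$ sends an $R$-module $M$ to the bundle with total space $\mathrm{Sym}_R(M)$ and structure (as ring morphisms, on generators $a\in R$, $m\in M$) $\mathsf q(a)=a$; $\sigma(a)=a\otimes1=1\otimes a$, $\sigma(m)=m\otimes1+1\otimes m$; $\mathsf z(a)=a$, $\mathsf z(m)=0$; $\iota(a)=a$, $\iota(m)=-m$; $\lambda(a)=a$, $\lambda(m)=0$, $\lambda(\mathsf d(a))=0$, $\lambda(\mathsf d(m))=m$. It sends an $R$-linear map $f:M\to M'$ to the bundle morphism $\mathsf M_R(M')\to\mathsf M_R(M)$ given by the ring morphism $\mathrm{Sym}_R(f):\mathrm{Sym}_R(M)\to\mathrm{Sym}_R(M')$. * $\mathsf M_R^\circ:\mathsf{DBUN}_{\mathbb T}[R]\to\mathsf{MOD}_R^{op}$ sends $\mathcal E=(\mathsf q,\sigma,\mathsf z,\lambda,\iota)$ with total space $E$ to the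 $R$-module $\mathrm{im}(\mathsf D_\lambda)\subseteq E$, where $\mathsf D_\lambda:E\to E$, $\mathsf D_\lambda(x)=\lambda(\mathsf d(x))$, with action $a\cdot\mathsf D_\lambda(x)=\mathsf q(a)\mathsf D_\lambda(x)=\mathsf D_\lambda(\mathsf q(a)x)$. It sends a morphism $\mathcal E\to\mathcal E'$ over $R$, that is, a ring morphism $f:E'\to E$, to the $R$-linear map $\mathrm{im}(\mathsf D_{\lambda'})\to\mathrm{im}(\mathsf D_\lambda)$, $\mathsf D_{\lambda'}(x)\mapsto\mathsf D_\lambda(f(x))$. Moreover, the functor forgetting $\iota$, from $\mathsf{DBUN}_{\mathbb T}[R]$ to the category of differential bundles over $R$ and morphisms over $R$, is an equivalence, so that the category of differential bundles (not required to have negatives) over $R$ is also equivalent to $\mathsf{MOD}_R^{op}$. -/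

import Mathlib

open CategoryTheory CategoryTheory.Limits Opposite

universe v u

noncomputable section

/-! ### Symmetric algebras and the tangent algebra of a commutative ring -/

/-- The ring homomorphism `Sym_R(M) → S` given on generators by `a ↦ f a`, `m ↦ g m`. -/
def symHom {R M S : Type u} [CommRing R] [AddCommGroup M] [Module R M] [CommRing S]
    (f : R →+* S) (g : M →+ S) (hg : ∀ (a : R) (m : M), g (a • m) = f a * g m) :
    SymmetricAlgebra R M →+* S :=
  letI : Algebra R S := f.toAlgebra
  (SymmetricAlgebra.lift (R := R) (M := M) (A := S)
    { toFun := g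
      map_add' := g.map_add
      map_smul' := fun a m => (hg a m).trans (Algebra.smul_def a (g m)).symm }).toRingHom

section
variable {R M S : Type u} [CommRing R] [AddCommGroup M] [Module R M] [CommRing S]

@[simp]
theorem symHom_algebraMap (f : R →+* S) (g : M →+ S) (hg) (a : R) :
    symHom f g hg (algebraMap R (SymmetricAlgebra R M) a) = f a := by
  let _ : Algebra R S := f.toAlgebra
  exact (SymmetricAlgebra.lift (R := R) (M := M) (A := S) _).commutes a

@[simp]
theorem symHom_ι (f : R →+* S) (g : M →+ S) (hg) (m : M) :
    symHom f g hg (SymmetricAlgebra.ι R M m) = g m := by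
  let _ : Algebra R S := f.toAlgebra
  exact SymmetricAlgebra.lift_ι_apply _ m

theorem symHom_ext {f g : SymmetricAlgebra R M →+* S}
    (h₁ : ∀ a, f (algebraMap R _ a) = g (algebraMap R _ a))
    (h₂ : ∀ m, f (SymmetricAlgebra.ι R M m) = g (SymmetricAlgebra.ι R M m)) : f = g := by
  refine RingHom.ext fun x => ?_
  induction x using SymmetricAlgebra.induction with
  | algebraMap r => exact h₁ r
  | ι m => exact h₂ m
  | mul a b ha hb => rw [map_mul, map_mul, ha, hb]
  | add a b ha hb => rw [map_add, map_add, ha, hb]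

theorem symHom_ext_of_span {s : Set M} (hs : Submodule.span R s = ⊤)
    {f g : SymmetricAlgebra R M →+* S}
    (h₁ : ∀ a, f (algebraMap R _ a) = g (algebraMap R _ a))
    (h₂ : ∀ m ∈ s, f (SymmetricAlgebra.ι R M m) = g (SymmetricAlgebra.ι R M m)) : f = g := by
  refine symHom_ext h₁ fun m => ?_
  have hm : m ∈ Submodule.span R s := by rw [hs]; trivial
  induction hm using Submodule.span_induction with
  | mem x hx => exact h₂ x hx
  | zero => simp
  | add x y _ _ hx hy => rw [map_add, map_add, map_add, hx, hy]
  | smul a x _ hx => rw [map_smul, Algebra.smul_def, map_mul, map_mul, hx, h₁]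

end

open scoped KaehlerDifferential in
/-- The tangent algebra `T(R) = Sym_R(Ω_R)`, where `Ω_R` is the module of (absolute) Kähler
differentials. -/
def Tan (R : Type u) [CommRing R] : Type u := SymmetricAlgebra R (Ω[R⁄ℤ])

instance (R : Type u) [CommRing R] : CommRing (Tan R) :=
  inferInstanceAs (CommRing (SymmetricAlgebra R (KaehlerDifferential ℤ R)))

namespace Tan

/-- The inclusion `R → T(R)`, `a ↦ a`. -/
def incl (R : Type u) [CommRing R] : R →+* Tan R :=
  algebraMap R (SymmetricAlgebra R (KaehlerDifferential ℤ R))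

/-- The universal derivation `d : R → T(R)`. -/
def d (R : Type u) [CommRing R] : R →+ Tan R :=
  ((SymmetricAlgebra.ι R (KaehlerDifferential ℤ R)).toAddMonoidHom).comp
    (KaehlerDifferential.D ℤ R).toLinearMap.toAddMonoidHom

section
variable {R S : Type u} [CommRing R] [CommRing S]

theorem d_mul (a b : R) : d R (a * b) = incl R a * d R b + incl R b * d R a := by
  change SymmetricAlgebra.ι R _ (KaehlerDifferential.D ℤ R (a * b)) = _
  rw [Derivation.leibniz, map_add, map_smul, map_smul, Algebra.smul_def, Algebra.smul_def]
  rfl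

/-- The ring homomorphism `T(R) → S` given on generators by `a ↦ f a`, `d(a) ↦ D a`. -/
def lift (f : R →+* S) (D : R →+ S) (hD : ∀ a b, D (a * b) = f a * D b + f b * D a) :
    Tan R →+* S :=
  letI : Algebra R S := f.toAlgebra
  let D' : Derivation ℤ R S := Derivation.mk' D.toIntLinearMap fun a b =>
    (hD a b).trans (congrArg₂ (· + ·) (Algebra.smul_def a (D b)).symm
      (Algebra.smul_def b (D a)).symm)
  symHom f D'.liftKaehlerDifferential.toAddMonoidHom fun a m =>
    (D'.liftKaehlerDifferential.map_smul a m).trans (Algebra.smul_def _ _)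

@[simp]
theorem lift_incl (f : R →+* S) (D : R →+ S) (hD) (a : R) : lift f D hD (incl R a) = f a := by
  unfold lift
  apply symHom_algebraMap

@[simp]
theorem lift_d (f : R →+* S) (D : R →+ S) (hD) (a : R) : lift f D hD (d R a) = D a := by
  let _ : Algebra R S := f.toAlgebra
  unfold lift
  refine Eq.trans (b := Derivation.liftKaehlerDifferential _ (KaehlerDifferential.D ℤ R a)) ?_
    (Derivation.liftKaehlerDifferential_comp_D (Derivation.mk' D.toIntLinearMap fun a b =>
      (hD a b).trans (congrArg₂ (· + ·) (Algebra.smul_def a (D b)).symm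
        (Algebra.smul_def b (D a)).symm)) a)
  apply symHom_ι

theorem hom_ext {f g : Tan R →+* S} (h₁ : ∀ a, f (incl R a) = g (incl R a))
    (h₂ : ∀ a, f (d R a) = g (d R a)) : f = g := by
  refine symHom_ext_of_span (KaehlerDifferential.span_range_derivation ℤ R) h₁ ?_
  rintro _ ⟨a, rfl⟩
  exact h₂ a

/-- The ring homomorphism `T(R) → S` corresponding to a ring homomorphism `g : R → S[ε]`: if
`g a = f a + (D a) ε`, then it is given on generators by `a ↦ f a`, `d(a) ↦ D a`. -/
def liftDual (g : R →+* DualNumber S) : Tan R →+* S :=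
  lift ((TrivSqZeroExt.fstHom S S S).toRingHom.comp g)
    ((TrivSqZeroExt.sndHom S S).toAddMonoidHom.comp g.toAddMonoidHom) fun a b => by
      simp [TrivSqZeroExt.snd_mul, mul_comm]

@[simp]
theorem liftDual_incl (g : R →+* DualNumber S) (a : R) :
    liftDual g (incl R a) = (g a).fst := lift_incl _ _ _ a

@[simp]
theorem liftDual_d (g : R →+* DualNumber S) (a : R) :
    liftDual g (d R a) = (g a).snd := lift_d _ _ _ a

/-- The ring homomorphism `R → S[ε]`, `a ↦ f a + (D a) ε`. -/
def toDual (f : R →+* S) (D : R →+ S) (hD : ∀ a b, D (a * b) = f a * D b + f b * D a) :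
    R →+* DualNumber S where
  toFun a := TrivSqZeroExt.inl (f a) + TrivSqZeroExt.inr (D a)
  map_one' := by
    have h := hD 1 1
    simp only [mul_one, map_one, one_mul, left_eq_add] at h
    exact TrivSqZeroExt.ext (by simp) (by simpa using h)
  map_mul' a b := TrivSqZeroExt.ext (by simp) (by
    simp [TrivSqZeroExt.snd_mul, hD, mul_comm])
  map_zero' := TrivSqZeroExt.ext (by simp) (by simp)
  map_add' a b := TrivSqZeroExt.ext (by simp) (by simp)

@[simp]
theorem toDual_fst (f : R →+* S) (D : R →+ S) (hD) (a : R) : (toDual f D hD a).fst = f a := by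
  simp [toDual]

@[simp]
theorem toDual_snd (f : R →+* S) (D : R →+ S) (hD) (a : R) : (toDual f D hD a).snd = D a := by
  simp [toDual]

/-- The functorial action `T(f) : T(R) → T(S)`, `a ↦ f a`, `d(a) ↦ d(f a)`. -/
def map (f : R →+* S) : Tan R →+* Tan S :=
  lift ((incl S).comp f) ((d S).comp f.toAddMonoidHom) fun a b => by simp [d_mul]

@[simp]
theorem map_incl (f : R →+* S) (a : R) : map f (incl R a) = incl S (f a) := lift_incl _ _ _ a

@[simp]
theorem map_d (f : R →+* S) (a : R) : map f (d R a) = d S (f a) := lift_d _ _ _ a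

theorem hom_ext₂ {f g : Tan (Tan R) →+* S}
    (h₁ : ∀ a, f (incl _ (incl R a)) = g (incl _ (incl R a)))
    (h₂ : ∀ a, f (incl _ (d R a)) = g (incl _ (d R a)))
    (h₃ : ∀ a, f (d _ (incl R a)) = g (d _ (incl R a)))
    (h₄ : ∀ a, f (d _ (d R a)) = g (d _ (d R a))) : f = g := by
  have key : toDual (f.comp (incl _)) (f.toAddMonoidHom.comp (d _)) (fun a b => by simp [d_mul]) =
      toDual (g.comp (incl _)) (g.toAddMonoidHom.comp (d _)) (fun a b => by simp [d_mul]) :=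
    hom_ext (fun a => TrivSqZeroExt.ext (by simpa using h₁ a) (by simpa using h₃ a)) (fun a => TrivSqZeroExt.ext (by simpa using h₂ a) (by simpa using h₄ a))
  exact hom_ext (fun x => by simpa using congrArg TrivSqZeroExt.fst (RingHom.congr_fun key x))
    (fun x => by simpa using congrArg TrivSqZeroExt.snd (RingHom.congr_fun key x))

theorem hom_ext₃ {f g : Tan (Tan (Tan R)) →+* S}
    (h₁ : ∀ a, f (incl _ (incl _ (incl R a))) = g (incl _ (incl _ (incl R a))))
    (h₂ : ∀ a, f (incl _ (incl _ (d R a))) = g (incl _ (incl _ (d R a))))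
    (h₃ : ∀ a, f (incl _ (d _ (incl R a))) = g (incl _ (d _ (incl R a))))
    (h₄ : ∀ a, f (incl _ (d _ (d R a))) = g (incl _ (d _ (d R a))))
    (h₅ : ∀ a, f (d _ (incl _ (incl R a))) = g (d _ (incl _ (incl R a))))
    (h₆ : ∀ a, f (d _ (incl _ (d R a))) = g (d _ (incl _ (d R a))))
    (h₇ : ∀ a, f (d _ (d _ (incl R a))) = g (d _ (d _ (incl R a))))
    (h₈ : ∀ a, f (d _ (d _ (d R a))) = g (d _ (d _ (d R a)))) : f = g := by
  have key : toDual (f.comp (incl _)) (f.toAddMonoidHom.comp (d _)) (fun a b => by simp [d_mul]) =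
      toDual (g.comp (incl _)) (g.toAddMonoidHom.comp (d _)) (fun a b => by simp [d_mul]) :=
    hom_ext₂ (fun a => TrivSqZeroExt.ext (by simpa using h₁ a) (by simpa using h₅ a)) (fun a => TrivSqZeroExt.ext (by simpa using h₂ a) (by simpa using h₆ a))
      (fun a => TrivSqZeroExt.ext (by simpa using h₃ a) (by simpa using h₇ a)) (fun a => TrivSqZeroExt.ext (by simpa using h₄ a) (by simpa using h₈ a))
  exact hom_ext (fun x => by simpa using congrArg TrivSqZeroExt.fst (RingHom.congr_fun key x))
    (fun x => by simpa using congrArg TrivSqZeroExt.snd (RingHom.congr_fun key x))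

end

/-- `0_R : T(R) → R`, `a ↦ a`, `d(a) ↦ 0`. -/
def zero (R : Type u) [CommRing R] : Tan R →+* R :=
  lift (RingHom.id R) 0 (by simp)

/-- `-_R : T(R) → T(R)`, `a ↦ a`, `d(a) ↦ -d(a)`. -/
def neg (R : Type u) [CommRing R] : Tan R →+* Tan R :=
  lift (incl R) (-d R) (by intro a b; simp [d_mul]; ring)

/-- The vertical lift `ℓ_R : T²(R) → T(R)`, `a ↦ a`, `d(a) ↦ 0`, `d'(a) ↦ 0`, `d'd(a) ↦ d(a)`. -/
def vlift (R : Type u) [CommRing R] : Tan (Tan R) →+* Tan R :=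
  liftDual (lift ((TrivSqZeroExt.inlHom (Tan R) (Tan R)).comp (incl R))
    ((TrivSqZeroExt.inrHom (Tan R) (Tan R)).toAddMonoidHom.comp (d R)) (by
      intro a b
      apply TrivSqZeroExt.ext <;> simp [d_mul, mul_comm]))

/-- The canonical flip `c_R : T²(R) → T²(R)`, `a ↦ a`, `d(a) ↦ d'(a)`, `d'(a) ↦ d(a)`,
`d'd(a) ↦ d'd(a)`. -/
def flip (R : Type u) [CommRing R] : Tan (Tan R) →+* Tan (Tan R) :=
  liftDual (lift
    (toDual ((incl (Tan R)).comp (incl R)) ((incl (Tan R)).toAddMonoidHom.comp (d R))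
      (by intro a b; simp [d_mul]))
    { toFun := fun a =>
        TrivSqZeroExt.inl (d (Tan R) (incl R a)) + TrivSqZeroExt.inr (d (Tan R) (d R a))
      map_zero' := TrivSqZeroExt.ext (by simp) (by simp)
      map_add' := fun a b => TrivSqZeroExt.ext (by simp) (by simp) }
    (by
      intro a b
      apply TrivSqZeroExt.ext
      · simp [d_mul]
      · simp [d_mul]; ring))

section
variable (R : Type u) [CommRing R] (a : R)

@[simp] theorem zero_incl : zero R (incl R a) = a := by simp [zero]
@[simp] theorem zero_d : zero R (d R a) = 0 := by simp [zero]
@[simp] theorem neg_incl : neg R (incl R a) = incl R a := by simp [neg]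
@[simp] theorem neg_d : neg R (d R a) = -d R a := by simp [neg]
@[simp] theorem vlift_incl_incl : vlift R (incl _ (incl R a)) = incl R a := by simp [vlift]
@[simp] theorem vlift_incl_d : vlift R (incl _ (d R a)) = 0 := by simp [vlift]
@[simp] theorem vlift_d_incl : vlift R (d _ (incl R a)) = 0 := by simp [vlift]
@[simp] theorem vlift_d_d : vlift R (d _ (d R a)) = d R a := by simp [vlift]
@[simp] theorem flip_incl_incl : flip R (incl _ (incl R a)) = incl _ (incl R a) := by simp [flip]
@[simp] theorem flip_incl_d : flip R (incl _ (d R a)) = d _ (incl R a) := by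
  simp [flip]
@[simp] theorem flip_d_incl : flip R (d _ (incl R a)) = incl _ (d R a) := by simp [flip]
@[simp] theorem flip_d_d : flip R (d _ (d R a)) = d _ (d R a) := by
  simp [flip]

end

end Tan

end


noncomputable section

/-! ### Tangent categories -/

section FibrePowers
variable {C : Type u} [Category.{v} C]

/-- The `n`-fold composite `Tⁿ` of an endofunctor. -/
def iterFunctor (T : C ⥤ C) : ℕ → (C ⥤ C)
  | 0 => 𝟭 C
  | n + 1 => iterFunctor T n ⋙ T

/-- For each `n`, the pullback of `n` copies of `q : E ⟶ A` exists. -/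
class HasFibrePowers {E A : C} (q : E ⟶ A) : Prop where
  has (n : ℕ) : HasWidePullback A (fun _ : Fin n => E) (fun _ => q)

attribute [instance] HasFibrePowers.has

/-- For all `n` and `m`, the pullback of `n` copies of `q : E ⟶ A` is preserved by `Tᵐ`. -/
class PreservesFibrePowers (T : C ⥤ C) {E A : C} (q : E ⟶ A) : Prop where
  preserves (n m : ℕ) : PreservesLimit
    (WidePullbackShape.wideCospan A (fun _ : Fin n => E) (fun _ => q)) (iterFunctor T m)

/-- `E_n`, the pullback of `n` copies of `q : E ⟶ A`. -/
def fibrePower {E A : C} (q : E ⟶ A) [HasFibrePowers q] (n : ℕ) : C :=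
  widePullback A (fun _ : Fin n => E) (fun _ => q)

/-- The projections `π_j : E_n ⟶ E` (indexed from `0`). -/
def fibreProj {E A : C} (q : E ⟶ A) [HasFibrePowers q] (n : ℕ) (j : Fin n) :
    fibrePower q n ⟶ E :=
  WidePullback.π (fun _ : Fin n => q) j

theorem fibreProj_comp {E A : C} (q : E ⟶ A) [HasFibrePowers q] (n : ℕ) (i j : Fin n) :
    fibreProj q n i ≫ q = fibreProj q n j ≫ q :=
  (WidePullback.π_arrow (fun _ : Fin n => q) i).trans
    (WidePullback.π_arrow (fun _ : Fin n => q) j).symm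

/-- The cone over two copies of `F(q)` with components `f` and `g`. -/
def widePairCone {D : Type u} [Category.{v} D] (F : C ⥤ D) {E A : C} (q : E ⟶ A) {X : D}
    (f g : X ⟶ F.obj E) (h : f ≫ F.map q = g ≫ F.map q) :
    Cone (WidePullbackShape.wideCospan A (fun _ : Fin 2 => E) (fun _ => q) ⋙ F) where
  pt := X
  π :=
    { app := fun j => match j with
        | none => f ≫ F.map q
        | some j => if j = 0 then f else g
      naturality := by
        rintro X _ (_ | j)
        · exact (Category.id_comp _).trans ((Category.comp_id _).symm.trans
            (congrArg _ (((WidePullbackShape.wideCospan A (fun _ : Fin 2 => E)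
              (fun _ => q)) ⋙ F).map_id X).symm))
        · fin_cases j
          · exact Category.id_comp _
          · exact (Category.id_comp _).trans h }

theorem isPullback_of_isLimit_wideCospan {D : Type u} [Category.{v} D] {E A : C} (q : E ⟶ A)
    (c : Cone (WidePullbackShape.wideCospan A (fun _ : Fin 2 => E) (fun _ => q))) (F : C ⥤ D)
    (hc : IsLimit (F.mapCone c)) (f g : c.pt ⟶ E) (hf : f = c.π.app (some 0))
    (hg : g = c.π.app (some 1)) :
    IsPullback (F.map f) (F.map g) (F.map q) (F.map q) := by
  have hw₀ : f ≫ q = c.π.app none := hf ▸ c.w (WidePullbackShape.Hom.term 0)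
  have hw₁ : g ≫ q = c.π.app none := hg ▸ c.w (WidePullbackShape.Hom.term 1)
  refine ⟨⟨by rw [← F.map_comp, ← F.map_comp, hw₀, hw₁]⟩,
    ⟨PullbackCone.IsLimit.mk _
      (fun s => hc.lift (widePairCone F q s.fst s.snd s.condition)) ?_ ?_ ?_⟩⟩
  · intro s
    rw [hf]
    exact hc.fac _ (some 0)
  · intro s
    rw [hg]
    exact hc.fac _ (some 1)
  · intro s m h₁ h₂
    refine hc.uniq (widePairCone F q s.fst s.snd s.condition) m fun j => ?_
    match j with
    | none =>
      refine (congrArg (m ≫ ·) (congrArg F.map hw₀.symm)).trans ?_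
      change m ≫ F.map (f ≫ q) = s.fst ≫ F.map q
      rw [F.map_comp, ← Category.assoc, h₁]
    | some ⟨0, _⟩ => exact (congrArg (m ≫ F.map ·) hf.symm).trans h₁
    | some ⟨1, _⟩ => exact (congrArg (m ≫ F.map ·) hg.symm).trans h₂

theorem fibrePower_isPullback {E A : C} (q : E ⟶ A) [HasFibrePowers q] :
    IsPullback (fibreProj q 2 0) (fibreProj q 2 1) q q :=
  isPullback_of_isLimit_wideCospan q _ (𝟭 C) (isLimitOfPreserves (𝟭 C) (limit.isLimit _)) _ _
    rfl rfl

theorem map_fibrePower_isPullback (T : C ⥤ C) {E A : C} (q : E ⟶ A) [HasFibrePowers q]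
    [PreservesFibrePowers T q] :
    IsPullback (T.map (fibreProj q 2 0)) (T.map (fibreProj q 2 1)) (T.map q) (T.map q) := by
  have : PreservesLimit (WidePullbackShape.wideCospan A (fun _ : Fin 2 => E) (fun _ => q)) T :=
    PreservesFibrePowers.preserves (T := T) (q := q) 2 1
  exact isPullback_of_isLimit_wideCospan q _ T (isLimitOfPreserves T (limit.isLimit _)) _ _
    rfl rfl

/-- The pairing `⟨f, g⟩ : X ⟶ E_2`. -/
def fibrePair {E A : C} (q : E ⟶ A) [HasFibrePowers q] {X : C} (f g : X ⟶ E)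
    (h : f ≫ q = g ≫ q) : X ⟶ fibrePower q 2 :=
  (fibrePower_isPullback q).lift f g h

/-- The pairing `⟨f, g⟩ : X ⟶ T(E_2)`, where `T(E_2)` is regarded as the pullback of two copies
of `T(q)`. -/
def mapFibrePair (T : C ⥤ C) {E A : C} (q : E ⟶ A) [HasFibrePowers q] [PreservesFibrePowers T q]
    {X : C} (f g : X ⟶ T.obj E) (h : f ≫ T.map q = g ≫ T.map q) : X ⟶ T.obj (fibrePower q 2) :=
  (map_fibrePower_isPullback T q).lift f g h

section
variable {E A : C} (q : E ⟶ A) [HasFibrePowers q] {X : C}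

@[simp]
theorem fibrePair_proj_zero (f g : X ⟶ E) (h) : fibrePair q f g h ≫ fibreProj q 2 0 = f :=
  IsPullback.lift_fst _ _ _ _

@[simp]
theorem fibrePair_proj_one (f g : X ⟶ E) (h) : fibrePair q f g h ≫ fibreProj q 2 1 = g :=
  IsPullback.lift_snd _ _ _ _

@[simp]
theorem mapFibrePair_proj_zero (T : C ⥤ C) [PreservesFibrePowers T q] (f g : X ⟶ T.obj E) (h) :
    mapFibrePair T q f g h ≫ T.map (fibreProj q 2 0) = f :=
  IsPullback.lift_fst _ _ _ _

@[simp]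
theorem mapFibrePair_proj_one (T : C ⥤ C) [PreservesFibrePowers T q] (f g : X ⟶ T.obj E) (h) :
    mapFibrePair T q f g h ≫ T.map (fibreProj q 2 1) = g :=
  IsPullback.lift_snd _ _ _ _

end

/-- `(q, σ, z)` is an additive bundle: a commutative monoid in the slice over `A`. -/
structure IsAdditiveBundle {E A : C} (q : E ⟶ A) [HasFibrePowers q] (σ : fibrePower q 2 ⟶ E)
    (z : A ⟶ E) : Prop where
  sum_proj (j : Fin 2) : σ ≫ q = fibreProj q 2 j ≫ q
  zero_proj : z ≫ q = 𝟙 A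
  assoc :
    fibrePair q
        (fibrePair q (fibreProj q 3 0) (fibreProj q 3 1) (fibreProj_comp q 3 0 1) ≫ σ)
        (fibreProj q 3 2)
        (by rw [Category.assoc, sum_proj 0, ← Category.assoc, fibrePair_proj_zero]
            exact fibreProj_comp q 3 0 2) ≫ σ =
      fibrePair q (fibreProj q 3 0)
        (fibrePair q (fibreProj q 3 1) (fibreProj q 3 2) (fibreProj_comp q 3 1 2) ≫ σ)
        (by rw [Category.assoc, sum_proj 0, ← Category.assoc, fibrePair_proj_zero]
            exact fibreProj_comp q 3 0 1) ≫ σ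
  zero_add : fibrePair q (q ≫ z) (𝟙 E)
    (by rw [Category.assoc, zero_proj, Category.comp_id, Category.id_comp]) ≫ σ = 𝟙 E
  add_zero : fibrePair q (𝟙 E) (q ≫ z)
    (by rw [Category.assoc, zero_proj, Category.comp_id, Category.id_comp]) ≫ σ = 𝟙 E
  comm : fibrePair q (fibreProj q 2 1) (fibreProj q 2 0) (fibreProj_comp q 2 1 0) ≫ σ = σ

/-- `ι` makes the additive bundle `(q, σ, z)` an Abelian group bundle. -/
structure IsBundleNegative {E A : C} (q : E ⟶ A) [HasFibrePowers q] (σ : fibrePower q 2 ⟶ E)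
    (z : A ⟶ E) (ι : E ⟶ E) : Prop where
  neg_proj : ι ≫ q = q
  add_neg : fibrePair q (𝟙 E) ι (by rw [neg_proj, Category.id_comp]) ≫ σ = q ≫ z
  neg_add : fibrePair q ι (𝟙 E) (by rw [neg_proj, Category.id_comp]) ≫ σ = q ≫ z

end FibrePowers

/-- A tangent structure on a category. Composites are written in diagrammatic order, and the
projections `π_j` are indexed from `0`. -/
structure TangentStructure (C : Type u) [Category.{v} C] where
  /-- the tangent bundle functor -/
  T : C ⥤ C
  /-- the projection -/
  p : T ⟶ 𝟭 C
  hasPowers (A : C) : HasFibrePowers (p.app A)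
  preservesPowers (A : C) : PreservesFibrePowers T (p.app A)
  /-- the sum -/
  add (A : C) : fibrePower (p.app A) 2 ⟶ T.obj A
  add_naturality {A B : C} (f : A ⟶ B) :
    add A ≫ T.map f =
      fibrePair (p.app B) (fibreProj (p.app A) 2 0 ≫ T.map f) (fibreProj (p.app A) 2 1 ≫ T.map f)
        (by simp only [Category.assoc, p.naturality]
            rw [← Category.assoc, fibreProj_comp (p.app A) 2 0 1, Category.assoc]) ≫ add B
  /-- the zero -/
  zero : 𝟭 C ⟶ T
  /-- the vertical lift -/
  lift : T ⟶ T ⋙ T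
  /-- the canonical flip -/
  flip : T ⋙ T ⟶ T ⋙ T
  additive (A : C) : IsAdditiveBundle (p.app A) (add A) (zero.app A)
  lift_proj (A : C) : lift.app A ≫ T.map (p.app A) = p.app A ≫ zero.app A
  lift_add (A : C) :
    mapFibrePair T (p.app A) (fibreProj (p.app A) 2 0 ≫ lift.app A)
        (fibreProj (p.app A) 2 1 ≫ lift.app A)
        (by rw [Category.assoc, Category.assoc, lift_proj, ← Category.assoc,
              fibreProj_comp (p.app A) 2 0 1, Category.assoc]) ≫ T.map (add A) =
      add A ≫ lift.app A
  lift_zero (A : C) : zero.app A ≫ lift.app A = zero.app A ≫ T.map (zero.app A)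
  flip_proj (A : C) : flip.app A ≫ p.app (T.obj A) = T.map (p.app A)
  flip_add (A : C) :
    fibrePair (p.app (T.obj A)) (T.map (fibreProj (p.app A) 2 0) ≫ flip.app A)
        (T.map (fibreProj (p.app A) 2 1) ≫ flip.app A)
        (by rw [Category.assoc, Category.assoc]
            erw [flip_proj]
            rw [← T.map_comp, ← T.map_comp, fibreProj_comp (p.app A) 2 0 1]) ≫ add (T.obj A) =
      T.map (add A) ≫ flip.app A
  flip_zero (A : C) : T.map (zero.app A) ≫ flip.app A = zero.app (T.obj A)
  flip_flip (A : C) : flip.app A ≫ flip.app A = 𝟙 _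
  yang_baxter (A : C) :
    T.map (flip.app A) ≫ flip.app (T.obj A) ≫ T.map (flip.app A) =
      flip.app (T.obj A) ≫ T.map (flip.app A) ≫ flip.app (T.obj A)
  lift_lift (A : C) : lift.app A ≫ lift.app (T.obj A) = lift.app A ≫ T.map (lift.app A)
  lift_flip (A : C) : lift.app A ≫ flip.app A = lift.app A
  lift_flip_flip (A : C) :
    lift.app (T.obj A) ≫ T.map (flip.app A) ≫ flip.app (T.obj A) =
      flip.app A ≫ T.map (lift.app A)
  /-- universality of the vertical lift, preserved by all `Tⁿ` -/
  universal (A : C) (n : ℕ) : IsPullback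
    ((iterFunctor T n).map
      (mapFibrePair T (p.app A) (fibreProj (p.app A) 2 0 ≫ lift.app A)
        (fibreProj (p.app A) 2 1 ≫ zero.app (T.obj A))
        (by rw [Category.assoc, Category.assoc, lift_proj]
            have h := zero.naturality (p.app A)
            dsimp only [Functor.id_map, Functor.id_obj] at h
            rw [← h, ← Category.assoc, fibreProj_comp (p.app A) 2 0 1, Category.assoc]) ≫
        T.map (add A)))
    ((iterFunctor T n).map (fibreProj (p.app A) 2 0 ≫ p.app A))
    ((iterFunctor T n).map (T.map (p.app A)))
    ((iterFunctor T n).map (zero.app A))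

attribute [instance] TangentStructure.hasPowers TangentStructure.preservesPowers

/-- A tangent structure with negatives (Rosický tangent structure). -/
structure RosickyTangentStructure (C : Type u) [Category.{v} C] extends TangentStructure C where
  /-- the negative -/
  neg : T ⟶ T
  negative (A : C) : IsBundleNegative (p.app A) (add A) (zero.app A) (neg.app A)

/-! ### Differential bundles -/

section
variable {C : Type u} [Category.{v} C]

/-- A differential bundle over `A` in the tangent category `(C, 𝕋)`. -/
structure DiffBundle (𝕋 : TangentStructure C) (A : C) where
  /-- the total space -/
  E : C
  /-- the projection -/
  q : E ⟶ A
  hasPowers : HasFibrePowers q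
  preservesPowers : PreservesFibrePowers 𝕋.T q
  /-- the sum -/
  σ : fibrePower q 2 ⟶ E
  /-- the zero -/
  z : A ⟶ E
  /-- the lift -/
  lam : E ⟶ 𝕋.T.obj E
  additive : IsAdditiveBundle q σ z
  lam_map_proj : lam ≫ 𝕋.T.map q = q ≫ 𝕋.zero.app A
  lam_map_add :
    mapFibrePair 𝕋.T q (fibreProj q 2 0 ≫ lam) (fibreProj q 2 1 ≫ lam)
        (by rw [Category.assoc, Category.assoc, lam_map_proj, ← Category.assoc,
              fibreProj_comp q 2 0 1, Category.assoc]) ≫ 𝕋.T.map σ =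
      σ ≫ lam
  lam_map_zero : z ≫ lam = 𝕋.zero.app A ≫ 𝕋.T.map z
  lam_proj : lam ≫ 𝕋.p.app E = q ≫ z
  lam_add :
    fibrePair (𝕋.p.app E) (fibreProj q 2 0 ≫ lam) (fibreProj q 2 1 ≫ lam)
        (by rw [Category.assoc, Category.assoc]
            erw [lam_proj]
            rw [← Category.assoc, fibreProj_comp q 2 0 1, Category.assoc]) ≫ 𝕋.add E =
      σ ≫ lam
  lam_zero : z ≫ lam = z ≫ 𝕋.zero.app E
  lam_lam : lam ≫ 𝕋.T.map lam = lam ≫ 𝕋.lift.app E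
  /-- universality of the lift, preserved by all `Tⁿ` -/
  universal (n : ℕ) : IsPullback
    ((iterFunctor 𝕋.T n).map
      (mapFibrePair 𝕋.T q (fibreProj q 2 0 ≫ lam) (fibreProj q 2 1 ≫ 𝕋.zero.app E)
        (by rw [Category.assoc, Category.assoc, lam_map_proj]
            have h := 𝕋.zero.naturality q
            dsimp only [Functor.id_map, Functor.id_obj] at h
            rw [← h, ← Category.assoc, fibreProj_comp q 2 0 1, Category.assoc]) ≫
        𝕋.T.map σ))
    ((iterFunctor 𝕋.T n).map (fibreProj q 2 0 ≫ q))
    ((iterFunctor 𝕋.T n).map (𝕋.T.map q))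
    ((iterFunctor 𝕋.T n).map (𝕋.zero.app A))

attribute [instance] DiffBundle.hasPowers DiffBundle.preservesPowers

/-- A differential bundle with negatives over `A`. -/
structure DiffBundleNeg (𝕋 : TangentStructure C) (A : C) extends DiffBundle 𝕋 A where
  /-- the negative -/
  ι : E ⟶ E
  negative : IsBundleNegative q σ z ι

/-- A differential bundle morphism over `A`. -/
@[ext]
structure DiffBundleHom {𝕋 : TangentStructure C} {A : C} (X Y : DiffBundle 𝕋 A) where
  /-- the underlying morphism of total spaces -/
  hom : X.E ⟶ Y.E
  proj : hom ≫ Y.q = X.q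
  lam : hom ≫ Y.lam = X.lam ≫ 𝕋.T.map hom

/-- The category of differential bundles over `A`. -/
instance DiffBundle.category (𝕋 : TangentStructure C) (A : C) : Category (DiffBundle 𝕋 A) where
  Hom X Y := DiffBundleHom X Y
  id X := ⟨𝟙 X.E, by simp, by simp⟩
  comp f g := ⟨f.hom ≫ g.hom, by rw [Category.assoc, g.proj, f.proj], by
    rw [Category.assoc, g.lam, ← Category.assoc, f.lam, 𝕋.T.map_comp, Category.assoc]⟩
  id_comp f := DiffBundleHom.ext (Category.id_comp f.hom)
  comp_id f := DiffBundleHom.ext (Category.comp_id f.hom)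
  assoc f g h := DiffBundleHom.ext (Category.assoc f.hom g.hom h.hom)

/-- The category of differential bundles with negatives over `A`; its morphisms are the
differential bundle morphisms over `A`. -/
instance DiffBundleNeg.category (𝕋 : TangentStructure C) (A : C) :
    Category (DiffBundleNeg 𝕋 A) where
  Hom X Y := DiffBundleHom X.toDiffBundle Y.toDiffBundle
  id X := 𝟙 X.toDiffBundle
  comp {X Y Z} f g :=
    CategoryStruct.comp (obj := DiffBundle 𝕋 A) (X := X.toDiffBundle) (Y := Y.toDiffBundle)
      (Z := Z.toDiffBundle) f g
  id_comp f := DiffBundleHom.ext (Category.id_comp f.hom)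
  comp_id f := DiffBundleHom.ext (Category.comp_id f.hom)
  assoc f g h := DiffBundleHom.ext (Category.assoc f.hom g.hom h.hom)

/-- The functor that forgets the negative. -/
def forgetNegative (𝕋 : TangentStructure C) (A : C) : DiffBundleNeg 𝕋 A ⥤ DiffBundle 𝕋 A where
  obj X := X.toDiffBundle
  map {X Y} f := show DiffBundleHom X.toDiffBundle Y.toDiffBundle from f

end

end

noncomputable section

/-! ### The tangent category of affine schemes -/

/-- The functor `T : CRING ⥤ CRING`, `R ↦ Sym_R(Ω_R)`. -/
@[reducible]
def tanFunctor : CommRingCat.{u} ⥤ CommRingCat.{u} where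
  obj R := CommRingCat.of (Tan R)
  map f := CommRingCat.ofHom (Tan.map f.hom)
  map_id R := CommRingCat.hom_ext (Tan.hom_ext (by intro a; simp) (by intro a; simp))
  map_comp f g := CommRingCat.hom_ext (Tan.hom_ext (by intro a; simp) (by intro a; simp))

/-- The tangent bundle functor on `CRINGᵒᵖ`. -/
@[reducible]
def affineT : CommRingCat.{u}ᵒᵖ ⥤ CommRingCat.{u}ᵒᵖ where
  obj A := op (CommRingCat.of (Tan A.unop))
  map f := (CommRingCat.ofHom (Tan.map f.unop.hom)).op
  map_id A := tanFunctor.op.map_id A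
  map_comp f g := tanFunctor.op.map_comp f g

/-- The functor `R ↦ R[ε]`. -/
@[reducible]
def dualFunctor : CommRingCat.{u} ⥤ CommRingCat.{u} where
  obj R := CommRingCat.of (DualNumber R)
  map {R S} f := CommRingCat.ofHom (Tan.toDual
    (f.hom.comp (TrivSqZeroExt.fstHom R R R).toRingHom)
    (f.hom.toAddMonoidHom.comp (TrivSqZeroExt.sndHom R R).toAddMonoidHom)
    (by intro a b; simp [TrivSqZeroExt.snd_mul, mul_comm]))
  map_id R := by
    refine CommRingCat.hom_ext (RingHom.ext fun x => ?_)
    apply TrivSqZeroExt.ext <;> simp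
  map_comp f g := by
    refine CommRingCat.hom_ext (RingHom.ext fun x => ?_)
    apply TrivSqZeroExt.ext <;> simp

/-- `T` is left adjoint to `R ↦ R[ε]`. -/
def tanAdjunction : tanFunctor.{u} ⊣ dualFunctor.{u} :=
  Adjunction.mkOfHomEquiv
    { homEquiv := fun R S =>
        { toFun := fun f => CommRingCat.ofHom (Tan.toDual (f.hom.comp (Tan.incl R))
            (f.hom.toAddMonoidHom.comp (Tan.d R)) (by intro a b; simp [Tan.d_mul]))
          invFun := fun g => CommRingCat.ofHom (Tan.liftDual g.hom)
          left_inv := fun f => CommRingCat.hom_ext (Tan.hom_ext (by intro a; simp)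
            (by intro a; simp))
          right_inv := fun g => CommRingCat.hom_ext (RingHom.ext fun x => by
            apply TrivSqZeroExt.ext <;> simp) }
      homEquiv_naturality_left_symm := fun f g =>
        CommRingCat.hom_ext (Tan.hom_ext (by intro a; simp [tanFunctor])
          (by intro a; simp [tanFunctor]))
      homEquiv_naturality_right := fun f g =>
        CommRingCat.hom_ext (RingHom.ext fun x => by
          apply TrivSqZeroExt.ext <;> simp [dualFunctor]) }

instance preservesLimits_iterFunctor_affineT (n : ℕ) :
    PreservesLimitsOfSize.{0, 0} (iterFunctor affineT.{u} n) := by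
  induction n with
  | zero => exact inferInstanceAs (PreservesLimitsOfSize.{0, 0} (𝟭 CommRingCat.{u}ᵒᵖ))
  | succ n ih =>
    have : PreservesColimitsOfSize.{0, 0} tanFunctor.{u} :=
      tanAdjunction.leftAdjoint_preservesColimits
    have : PreservesLimitsOfSize.{0, 0} affineT.{u} :=
      preservesLimitsOfSize_op tanFunctor.{u}
    exact inferInstanceAs (PreservesLimitsOfSize.{0, 0}
      (iterFunctor affineT.{u} n ⋙ affineT.{u}))

instance {E A : CommRingCat.{u}ᵒᵖ} (q : E ⟶ A) : HasFibrePowers q := ⟨fun _ => inferInstance⟩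

instance {E A : CommRingCat.{u}ᵒᵖ} (q : E ⟶ A) : PreservesFibrePowers affineT.{u} q :=
  ⟨fun _ _ => inferInstance⟩

section

theorem opHom_ext {X Y : CommRingCat.{u}ᵒᵖ} {f g : X ⟶ Y} (h : f.unop.hom = g.unop.hom) : f = g :=
  Quiver.Hom.unop_inj (CommRingCat.hom_ext h)

theorem opHom_congr {X Y : CommRingCat.{u}ᵒᵖ} {f g : X ⟶ Y} (h : f = g) (x : Y.unop) :
    f.unop.hom x = g.unop.hom x := by rw [h]

theorem opHom_comp {X Y Z : CommRingCat.{u}ᵒᵖ} (f : X ⟶ Y) (g : Y ⟶ Z) (x : Z.unop) :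
    (f ≫ g).unop.hom x = f.unop.hom (g.unop.hom x) := rfl

theorem opHom_id {X : CommRingCat.{u}ᵒᵖ} (x : X.unop) : (𝟙 X : X ⟶ X).unop.hom x = x := rfl

variable {E A X : CommRingCat.{u}ᵒᵖ} (q : E ⟶ A)

theorem fibreProj_unop (n : ℕ) (i j : Fin n) (a : A.unop) :
    (fibreProj q n i).unop.hom (q.unop.hom a) = (fibreProj q n j).unop.hom (q.unop.hom a) :=
  opHom_congr (fibreProj_comp q n i j) a

@[simp]
theorem fibrePair_unop_zero (f g : X ⟶ E) (h) (x : E.unop) :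
    (fibrePair q f g h).unop.hom ((fibreProj q 2 0).unop.hom x) = f.unop.hom x :=
  opHom_congr (fibrePair_proj_zero q f g h) x

@[simp]
theorem fibrePair_unop_one (f g : X ⟶ E) (h) (x : E.unop) :
    (fibrePair q f g h).unop.hom ((fibreProj q 2 1).unop.hom x) = g.unop.hom x :=
  opHom_congr (fibrePair_proj_one q f g h) x

@[simp]
theorem mapFibrePair_unop_zero_incl (f g : X ⟶ affineT.obj E) (h) (x : E.unop) :
    (mapFibrePair affineT q f g h).unop.hom
      (Tan.incl _ ((fibreProj q 2 0).unop.hom x)) = f.unop.hom (Tan.incl _ x) := by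
  have := opHom_congr (mapFibrePair_proj_zero q affineT f g h) (Tan.incl _ x)
  rw [opHom_comp] at this
  exact (congrArg _ (Tan.map_incl _ _).symm).trans this

@[simp]
theorem mapFibrePair_unop_zero_d (f g : X ⟶ affineT.obj E) (h) (x : E.unop) :
    (mapFibrePair affineT q f g h).unop.hom
      (Tan.d _ ((fibreProj q 2 0).unop.hom x)) = f.unop.hom (Tan.d _ x) := by
  have := opHom_congr (mapFibrePair_proj_zero q affineT f g h) (Tan.d _ x)
  rw [opHom_comp] at this
  exact (congrArg _ (Tan.map_d _ _).symm).trans this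

@[simp]
theorem mapFibrePair_unop_one_incl (f g : X ⟶ affineT.obj E) (h) (x : E.unop) :
    (mapFibrePair affineT q f g h).unop.hom
      (Tan.incl _ ((fibreProj q 2 1).unop.hom x)) = g.unop.hom (Tan.incl _ x) := by
  have := opHom_congr (mapFibrePair_proj_one q affineT f g h) (Tan.incl _ x)
  rw [opHom_comp] at this
  exact (congrArg _ (Tan.map_incl _ _).symm).trans this

@[simp]
theorem mapFibrePair_unop_one_d (f g : X ⟶ affineT.obj E) (h) (x : E.unop) :
    (mapFibrePair affineT q f g h).unop.hom
      (Tan.d _ ((fibreProj q 2 1).unop.hom x)) = g.unop.hom (Tan.d _ x) := by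
  have := opHom_congr (mapFibrePair_proj_one q affineT f g h) (Tan.d _ x)
  rw [opHom_comp] at this
  exact (congrArg _ (Tan.map_d _ _).symm).trans this

theorem fibrePower_hom_ext {f g : X ⟶ fibrePower q 2}
    (h₀ : ∀ x, f.unop.hom ((fibreProj q 2 0).unop.hom x) =
      g.unop.hom ((fibreProj q 2 0).unop.hom x))
    (h₁ : ∀ x, f.unop.hom ((fibreProj q 2 1).unop.hom x) =
      g.unop.hom ((fibreProj q 2 1).unop.hom x)) : f = g :=
  (fibrePower_isPullback q).hom_ext (opHom_ext (RingHom.ext h₀)) (opHom_ext (RingHom.ext h₁))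

theorem fibrePower_ringHom_ext {S : CommRingCat.{u}} {c c' : (fibrePower q 2).unop →+* S}
    (h₀ : c.comp (fibreProj q 2 0).unop.hom = c'.comp (fibreProj q 2 0).unop.hom)
    (h₁ : c.comp (fibreProj q 2 1).unop.hom = c'.comp (fibreProj q 2 1).unop.hom) : c = c' := by
  have key : (CommRingCat.ofHom c).op = (CommRingCat.ofHom c').op :=
    fibrePower_hom_ext q (RingHom.congr_fun h₀) (RingHom.congr_fun h₁)
  exact congrArg (fun f => f.unop.hom) key

@[simp]
theorem affineT_map_incl (f : X ⟶ E) (x : E.unop) :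
    (affineT.map f).unop.hom (Tan.incl _ x) = Tan.incl _ (f.unop.hom x) :=
  Tan.map_incl _ _

@[simp]
theorem affineT_map_d (f : X ⟶ E) (x : E.unop) :
    (affineT.map f).unop.hom (Tan.d _ x) = Tan.d _ (f.unop.hom x) :=
  Tan.map_d _ _

end

/-- The projection `p_R : R → T(R)`, `a ↦ a`, in the opposite category. -/
@[reducible]
def affineProjAt (A : CommRingCat.{u}ᵒᵖ) : op (CommRingCat.of (Tan A.unop)) ⟶ A :=
  (CommRingCat.ofHom (Tan.incl A.unop)).op

@[simp]
theorem affineProjAt_unop (A : CommRingCat.{u}ᵒᵖ) (a : A.unop) :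
    (affineProjAt A).unop.hom a = Tan.incl A.unop a := rfl

/-- The natural transformation `p`. -/
@[reducible]
def affineProj : affineT.{u} ⟶ 𝟭 CommRingCat.{u}ᵒᵖ where
  app A := affineProjAt A
  naturality A B f := opHom_ext (RingHom.ext fun a => by simp)

theorem affineAdd_aux (A : CommRingCat.{u}ᵒᵖ) (a b : A.unop) :
    ((fibreProj (affineProjAt A) 2 0).unop.hom.toAddMonoidHom.comp (Tan.d A.unop) +
      (fibreProj (affineProjAt A) 2 1).unop.hom.toAddMonoidHom.comp (Tan.d A.unop)) (a * b) =
    ((fibreProj (affineProjAt A) 2 0).unop.hom.comp (Tan.incl A.unop)) a *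
      ((fibreProj (affineProjAt A) 2 0).unop.hom.toAddMonoidHom.comp (Tan.d A.unop) +
      (fibreProj (affineProjAt A) 2 1).unop.hom.toAddMonoidHom.comp (Tan.d A.unop)) b +
    ((fibreProj (affineProjAt A) 2 0).unop.hom.comp (Tan.incl A.unop)) b *
      ((fibreProj (affineProjAt A) 2 0).unop.hom.toAddMonoidHom.comp (Tan.d A.unop) +
      (fibreProj (affineProjAt A) 2 1).unop.hom.toAddMonoidHom.comp (Tan.d A.unop)) a := by
  have h : ∀ a, (fibreProj (affineProjAt A) 2 1).unop.hom (Tan.incl A.unop a) =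
      (fibreProj (affineProjAt A) 2 0).unop.hom (Tan.incl A.unop a) :=
    fibreProj_unop (affineProjAt A) 2 1 0
  simp only [RingHom.toAddMonoidHom_eq_coe, AddMonoidHom.add_apply, AddMonoidHom.comp_apply,
    AddMonoidHom.coe_coe, RingHom.comp_apply, Tan.d_mul, map_add, map_mul, h]
  ring

/-- The sum `+_R : T(R) → T₂(R)`, `a ↦ π₁(a) = π₂(a)`, `d(a) ↦ π₁(d(a)) + π₂(d(a))`. -/
def affineAddHom (A : CommRingCat.{u}ᵒᵖ) :
    Tan A.unop →+* (fibrePower (affineProjAt A) 2).unop :=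
  Tan.lift
    ((fibreProj (affineProjAt A) 2 0).unop.hom.comp (Tan.incl A.unop))
    ((fibreProj (affineProjAt A) 2 0).unop.hom.toAddMonoidHom.comp (Tan.d A.unop) +
      (fibreProj (affineProjAt A) 2 1).unop.hom.toAddMonoidHom.comp (Tan.d A.unop))
    (affineAdd_aux A)

/-- The sum, as a morphism in the opposite category. -/
@[reducible]
def affineAdd (A : CommRingCat.{u}ᵒᵖ) :
    fibrePower (affineProjAt A) 2 ⟶ op (CommRingCat.of (Tan A.unop)) :=
  (CommRingCat.ofHom (affineAddHom A)).op

/-- The zero `0_R : T(R) → R`, `a ↦ a`, `d(a) ↦ 0`. -/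
@[reducible]
def affineZero : 𝟭 CommRingCat.{u}ᵒᵖ ⟶ affineT.{u} where
  app A := (CommRingCat.ofHom (Tan.zero A.unop)).op
  naturality A B f := opHom_ext (Tan.hom_ext (by intro a; simp) (by intro a; simp))

/-- The vertical lift `ℓ_R : T²(R) → T(R)`. -/
@[reducible]
def affineLift : affineT.{u} ⟶ affineT.{u} ⋙ affineT.{u} where
  app A := (CommRingCat.ofHom (Tan.vlift A.unop)).op
  naturality A B f := opHom_ext (Tan.hom_ext₂ (by intro a; simp) (by intro a; simp)
    (by intro a; simp) (by intro a; simp))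

/-- The canonical flip `c_R : T²(R) → T²(R)`. -/
@[reducible]
def affineFlip : affineT.{u} ⋙ affineT.{u} ⟶
    affineT.{u} ⋙ affineT.{u} where
  app A := (CommRingCat.ofHom (Tan.flip A.unop)).op
  naturality A B f := opHom_ext (Tan.hom_ext₂ (by intro a; simp) (by intro a; simp)
    (by intro a; simp) (by intro a; simp))

/-- The negative `-_R : T(R) → T(R)`. -/
@[reducible]
def affineNeg : affineT.{u} ⟶ affineT.{u} where
  app A := (CommRingCat.ofHom (Tan.neg A.unop)).op
  naturality A B f := opHom_ext (Tan.hom_ext (by intro a; simp) (by intro a; simp))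

section
variable (A : CommRingCat.{u}ᵒᵖ) (a : A.unop)

@[simp]
theorem affineAddHom_incl : affineAddHom A (Tan.incl A.unop a) =
    (fibreProj (affineProjAt A) 2 0).unop.hom (Tan.incl A.unop a) :=
  by
  exact Tan.lift_incl _ _ (affineAdd_aux A) a

@[simp]
theorem affineAddHom_d : affineAddHom A (Tan.d A.unop a) =
    (fibreProj (affineProjAt A) 2 0).unop.hom (Tan.d A.unop a) +
      (fibreProj (affineProjAt A) 2 1).unop.hom (Tan.d A.unop a) :=
  by
  exact Tan.lift_d _ _ (affineAdd_aux A) a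

@[simp]
theorem fibreProj_two_one_incl :
    (fibreProj (affineProjAt A) 2 1).unop.hom (Tan.incl A.unop a) =
      (fibreProj (affineProjAt A) 2 0).unop.hom (Tan.incl A.unop a) :=
  fibreProj_unop (affineProjAt A) 2 1 0 a

@[simp]
theorem fibreProj_three_one_incl :
    (fibreProj (affineProjAt A) 3 1).unop.hom (Tan.incl A.unop a) =
      (fibreProj (affineProjAt A) 3 0).unop.hom (Tan.incl A.unop a) :=
  fibreProj_unop (affineProjAt A) 3 1 0 a

@[simp]
theorem fibreProj_three_two_incl :
    (fibreProj (affineProjAt A) 3 2).unop.hom (Tan.incl A.unop a) =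
      (fibreProj (affineProjAt A) 3 0).unop.hom (Tan.incl A.unop a) :=
  fibreProj_unop (affineProjAt A) 3 2 0 a

end

/-- A criterion for pullback squares in `CRINGᵒᵖ`. -/
theorem isPullback_op {P X Y Z : CommRingCat.{u}ᵒᵖ} {fst : P ⟶ X} {snd : P ⟶ Y} {f : X ⟶ Z}
    {g : Y ⟶ Z} (w : fst ≫ f = snd ≫ g)
    (hex : ∀ (S : CommRingCat.{u}) (a : X.unop →+* S) (b : Y.unop →+* S),
      (∀ x, a (f.unop.hom x) = b (g.unop.hom x)) →
      ∃ c : P.unop →+* S, (∀ x, c (fst.unop.hom x) = a x) ∧ ∀ y, c (snd.unop.hom y) = b y)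
    (huniq : ∀ (S : CommRingCat.{u}) (c c' : P.unop →+* S),
      (∀ x, c (fst.unop.hom x) = c' (fst.unop.hom x)) →
      (∀ y, c (snd.unop.hom y) = c' (snd.unop.hom y)) → c = c') :
    IsPullback fst snd f g := by
  have hex' : ∀ s : PullbackCone f g, ∃ l : s.pt ⟶ P, l ≫ fst = s.fst ∧ l ≫ snd = s.snd := by
    intro s
    obtain ⟨c, h₁, h₂⟩ := hex s.pt.unop s.fst.unop.hom s.snd.unop.hom
      (fun x => opHom_congr s.condition x)
    exact ⟨(CommRingCat.ofHom c).op, opHom_ext (RingHom.ext h₁), opHom_ext (RingHom.ext h₂)⟩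
  choose l h₁ h₂ using hex'
  refine ⟨⟨w⟩, ⟨PullbackCone.IsLimit.mk _ l h₁ h₂ fun s m hm₁ hm₂ => opHom_ext ?_⟩⟩
  exact huniq _ _ _ (fun x => (opHom_congr hm₁ x).trans (opHom_congr (h₁ s) x).symm)
    (fun x => (opHom_congr hm₂ x).trans (opHom_congr (h₂ s) x).symm)

set_option linter.unusedSimpArgs false

theorem affineAdditive (A : CommRingCat.{u}ᵒᵖ) :
    IsAdditiveBundle (affineProjAt A) (affineAdd A) (affineZero.app A) where
  sum_proj j := match j with
    | 0 => opHom_ext (RingHom.ext fun a => by simp)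
    | 1 => opHom_ext (RingHom.ext fun a => by simp [fibreProj_two_one_incl A])
  zero_proj := opHom_ext (RingHom.ext fun a => by simp)
  assoc := by
    refine opHom_ext (Tan.hom_ext ?_ ?_) <;> intro a <;>
      simp [fibrePair_unop_zero (affineProjAt A), fibrePair_unop_one (affineProjAt A), add_assoc]
  zero_add := by
    refine opHom_ext (Tan.hom_ext ?_ ?_) <;> intro a <;>
      simp [fibrePair_unop_zero (affineProjAt A), fibrePair_unop_one (affineProjAt A)]
  add_zero := by
    refine opHom_ext (Tan.hom_ext ?_ ?_) <;> intro a <;>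
      simp [fibrePair_unop_zero (affineProjAt A), fibrePair_unop_one (affineProjAt A)]
  comm := by
    refine opHom_ext (Tan.hom_ext ?_ ?_) <;> intro a <;>
      simp [fibrePair_unop_zero (affineProjAt A), fibrePair_unop_one (affineProjAt A),
        fibreProj_two_one_incl A, add_comm]

/-- The tangent structure with negatives on `CRINGᵒᵖ`. -/
@[reducible]
def affineTangent : RosickyTangentStructure CommRingCat.{u}ᵒᵖ where
  T := affineT
  p := affineProj
  hasPowers _ := inferInstance
  preservesPowers _ := inferInstance
  add := affineAdd
  add_naturality {A B} f := by
    refine opHom_ext (Tan.hom_ext ?_ ?_) <;> intro a <;>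
      simp [fibrePair_unop_zero (affineProjAt B), fibrePair_unop_one (affineProjAt B)]
  zero := affineZero
  lift := affineLift
  flip := affineFlip
  additive := affineAdditive
  lift_proj A := by
    refine opHom_ext (Tan.hom_ext ?_ ?_) <;> intro a <;> simp
  lift_add A := by
    refine opHom_ext (Tan.hom_ext₂ ?_ ?_ ?_ ?_) <;> intro a <;>
      simp [mapFibrePair_unop_zero_incl (affineProjAt A),
        mapFibrePair_unop_zero_d (affineProjAt A), mapFibrePair_unop_one_incl (affineProjAt A),
        mapFibrePair_unop_one_d (affineProjAt A)]
  lift_zero A := by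
    refine opHom_ext (Tan.hom_ext₂ ?_ ?_ ?_ ?_) <;> intro a <;> simp
  flip_proj A := by
    refine opHom_ext (Tan.hom_ext ?_ ?_) <;> intro a <;> simp
  flip_add A := by
    refine opHom_ext (Tan.hom_ext₂ ?_ ?_ ?_ ?_) <;> intro a <;>
      simp [fibrePair_unop_zero (affineProjAt (affineT.obj A)),
        fibrePair_unop_one (affineProjAt (affineT.obj A)), affineAddHom_incl (affineT.obj A),
        affineAddHom_d (affineT.obj A)]
  flip_zero A := by
    refine opHom_ext (Tan.hom_ext₂ ?_ ?_ ?_ ?_) <;> intro a <;> simp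
  flip_flip A := by
    refine opHom_ext (Tan.hom_ext₂ ?_ ?_ ?_ ?_) <;> intro a <;> simp
  yang_baxter A := by
    refine opHom_ext (Tan.hom_ext₃ ?_ ?_ ?_ ?_ ?_ ?_ ?_ ?_) <;> intro a <;> simp
  lift_lift A := by
    refine opHom_ext (Tan.hom_ext₃ ?_ ?_ ?_ ?_ ?_ ?_ ?_ ?_) <;> intro a <;> simp
  lift_flip A := by
    refine opHom_ext (Tan.hom_ext₂ ?_ ?_ ?_ ?_) <;> intro a <;> simp
  lift_flip_flip A := by
    refine opHom_ext (Tan.hom_ext₃ ?_ ?_ ?_ ?_ ?_ ?_ ?_ ?_) <;> intro a <;> simp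
  universal A n := by
    refine IsPullback.map (iterFunctor affineT n) (isPullback_op ?_ ?_ ?_)
    · refine opHom_ext (Tan.hom_ext ?_ ?_) <;> intro a <;>
        simp [mapFibrePair_unop_zero_incl (affineProjAt A),
        mapFibrePair_unop_zero_d (affineProjAt A), mapFibrePair_unop_one_incl (affineProjAt A),
        mapFibrePair_unop_one_d (affineProjAt A)]
    · intro S a b h
      have hi : ∀ x, a (Tan.incl _ (Tan.incl _ x)) = b x := fun x => by
        simpa using h (Tan.incl A.unop x)
      have hd : ∀ x, a (Tan.d _ (Tan.incl _ x)) = 0 := fun x => by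
        simpa using h (Tan.d A.unop x)
      let f₀ : Tan A.unop →+* S := Tan.lift b
        (a.toAddMonoidHom.comp ((Tan.d (Tan A.unop)).comp (Tan.d A.unop)))
        (by intro x y; simp [Tan.d_mul, hi, hd])
      let f₁ : Tan A.unop →+* S := Tan.lift b
        (a.toAddMonoidHom.comp ((Tan.incl (Tan A.unop)).toAddMonoidHom.comp (Tan.d A.unop)))
        (by intro x y; simp [Tan.d_mul, hi])
      let g₀ : op (CommRingCat.of S) ⟶ op (CommRingCat.of (Tan A.unop)) := (CommRingCat.ofHom f₀).op
      let g₁ : op (CommRingCat.of S) ⟶ op (CommRingCat.of (Tan A.unop)) := (CommRingCat.ofHom f₁).op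
      have hg : g₀ ≫ affineProjAt A = g₁ ≫ affineProjAt A :=
        opHom_ext (RingHom.ext fun x => by simp [g₀, g₁, f₀, f₁])
      have h₀ : ∀ x, (fibrePair (affineProjAt A) g₀ g₁ hg).unop.hom
          ((fibreProj (affineProjAt A) 2 0).unop.hom x) = f₀ x :=
        fibrePair_unop_zero (affineProjAt A) g₀ g₁ hg
      have h₁ : ∀ x, (fibrePair (affineProjAt A) g₀ g₁ hg).unop.hom
          ((fibreProj (affineProjAt A) 2 1).unop.hom x) = f₁ x :=
        fibrePair_unop_one (affineProjAt A) g₀ g₁ hg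
      refine ⟨(fibrePair (affineProjAt A) g₀ g₁ hg).unop.hom, ?_, ?_⟩
      · refine RingHom.congr_fun
          (f := RingHom.comp (fibrePair (affineProjAt A) g₀ g₁ hg).unop.hom _)
          (Tan.hom_ext₂ ?_ ?_ ?_ ?_) <;> intro x <;>
        simp [mapFibrePair_unop_zero_incl (affineProjAt A),
            mapFibrePair_unop_zero_d (affineProjAt A), mapFibrePair_unop_one_incl (affineProjAt A),
            mapFibrePair_unop_one_d (affineProjAt A), h₀, h₁, hi, hd, f₀, f₁]
      · intro y
        simp [h₀, f₀]
    · intro S c c' h₁ h₂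
      have e₀ : ∀ x, c ((fibreProj (affineProjAt A) 2 0).unop.hom (Tan.incl _ x)) =
          c' ((fibreProj (affineProjAt A) 2 0).unop.hom (Tan.incl _ x)) := h₂
      have e₁ : ∀ x, c ((fibreProj (affineProjAt A) 2 1).unop.hom (Tan.incl _ x)) =
          c' ((fibreProj (affineProjAt A) 2 1).unop.hom (Tan.incl _ x)) := fun x => by
        simpa [fibreProj_two_one_incl A] using e₀ x
      have e₂ : ∀ x, c ((fibreProj (affineProjAt A) 2 0).unop.hom (Tan.d _ x)) =
          c' ((fibreProj (affineProjAt A) 2 0).unop.hom (Tan.d _ x)) := fun x => by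
        simpa [mapFibrePair_unop_zero_incl (affineProjAt A),
            mapFibrePair_unop_zero_d (affineProjAt A), mapFibrePair_unop_one_incl (affineProjAt A),
            mapFibrePair_unop_one_d (affineProjAt A)] using h₁ (Tan.d _ (Tan.d _ x))
      have e₃ : ∀ x, c ((fibreProj (affineProjAt A) 2 1).unop.hom (Tan.d _ x)) =
          c' ((fibreProj (affineProjAt A) 2 1).unop.hom (Tan.d _ x)) := fun x => by
        simpa [mapFibrePair_unop_zero_incl (affineProjAt A),
            mapFibrePair_unop_zero_d (affineProjAt A), mapFibrePair_unop_one_incl (affineProjAt A),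
            mapFibrePair_unop_one_d (affineProjAt A)] using h₁ (Tan.incl _ (Tan.d _ x))
      exact fibrePower_ringHom_ext (affineProjAt A) (Tan.hom_ext e₀ e₂) (Tan.hom_ext e₁ e₃)
  neg := affineNeg
  negative A :=
    { neg_proj := opHom_ext (RingHom.ext fun a => by simp)
      add_neg := by
        refine opHom_ext (Tan.hom_ext ?_ ?_) <;> intro a <;>
          simp [fibrePair_unop_zero (affineProjAt A), fibrePair_unop_one (affineProjAt A)]
      neg_add := by
        refine opHom_ext (Tan.hom_ext ?_ ?_) <;> intro a <;>
          simp [fibrePair_unop_zero (affineProjAt A), fibrePair_unop_one (affineProjAt A)] }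

end

/-! ### The functors between modules and differential bundles -/

noncomputable section

section
variable (R : CommRingCat.{u}) (M : Type u) [AddCommGroup M] [Module R M]

/-- The projection `q(a) = a`. -/
@[reducible]
def symProj : op (CommRingCat.of (SymmetricAlgebra R M)) ⟶ op R :=
  (CommRingCat.ofHom (algebraMap R (SymmetricAlgebra R M))).op

/-- The inclusion of the generators, as an additive map. -/
def symGen : M →+ SymmetricAlgebra R M := (SymmetricAlgebra.ι R M).toAddMonoidHom

theorem symGen_apply (m : M) : symGen R M m = SymmetricAlgebra.ι R M m := rfl

theorem symGen_smul (a : R) (m : M) :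
    symGen R M (a • m) = algebraMap R (SymmetricAlgebra R M) a * symGen R M m := by
  rw [symGen_apply, symGen_apply, map_smul, Algebra.smul_def]

/-- `Sym_R(M) → Sym_R(M) ⊗_R Sym_R(M)`, `a ↦ a`, `m ↦ m ⊗ 1 + 1 ⊗ m`. -/
def symAddHom : SymmetricAlgebra R M →+* (fibrePower (symProj R M) 2).unop :=
  symHom ((fibreProj (symProj R M) 2 0).unop.hom.comp (algebraMap R (SymmetricAlgebra R M)))
    ((fibreProj (symProj R M) 2 0).unop.hom.toAddMonoidHom.comp (symGen R M) +
      (fibreProj (symProj R M) 2 1).unop.hom.toAddMonoidHom.comp (symGen R M)) (by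
    intro a m
    have h : (fibreProj (symProj R M) 2 1).unop.hom (algebraMap R (SymmetricAlgebra R M) a) =
        (fibreProj (symProj R M) 2 0).unop.hom (algebraMap R (SymmetricAlgebra R M) a) :=
      fibreProj_unop (symProj R M) 2 1 0 a
    simp only [RingHom.toAddMonoidHom_eq_coe, AddMonoidHom.add_apply, AddMonoidHom.comp_apply,
      AddMonoidHom.coe_coe, RingHom.comp_apply, symGen_smul, map_mul, h]
    ring)

/-- `Sym_R(M) → R`, `a ↦ a`, `m ↦ 0`. -/
def symZeroHom : SymmetricAlgebra R M →+* R := symHom (RingHom.id R) 0 (by simp)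

/-- `Sym_R(M) → Sym_R(M)`, `a ↦ a`, `m ↦ -m`. -/
def symNegHom : SymmetricAlgebra R M →+* SymmetricAlgebra R M :=
  symHom (algebraMap R (SymmetricAlgebra R M)) (-symGen R M) (by
    intro a m
    simp [symGen_smul])

/-- `T(Sym_R(M)) → Sym_R(M)`, `a ↦ a`, `m ↦ 0`, `d(a) ↦ 0`, `d(m) ↦ m`. -/
def symLiftHom : Tan (SymmetricAlgebra R M) →+* SymmetricAlgebra R M :=
  Tan.liftDual (symHom
    ((TrivSqZeroExt.inlHom (SymmetricAlgebra R M) (SymmetricAlgebra R M)).comp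
      (algebraMap R (SymmetricAlgebra R M)))
    ((TrivSqZeroExt.inrHom (SymmetricAlgebra R M) (SymmetricAlgebra R M)).toAddMonoidHom.comp
      (symGen R M)) (by
      intro a m
      apply TrivSqZeroExt.ext <;> simp [symGen_smul, mul_comm]))

section
variable (a : R) (m : M)

@[simp]
theorem symAddHom_algebraMap : symAddHom R M (algebraMap R _ a) =
    (fibreProj (symProj R M) 2 0).unop.hom (algebraMap R (SymmetricAlgebra R M) a) :=
  symHom_algebraMap _ _ _ a

@[simp]
theorem symAddHom_ι : symAddHom R M (SymmetricAlgebra.ι R M m) =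
    (fibreProj (symProj R M) 2 0).unop.hom (SymmetricAlgebra.ι R M m) +
      (fibreProj (symProj R M) 2 1).unop.hom (SymmetricAlgebra.ι R M m) :=
  symHom_ι _ _ _ m

@[simp]
theorem symZeroHom_algebraMap : symZeroHom R M (algebraMap R _ a) = a := symHom_algebraMap _ _ _ a

@[simp]
theorem symZeroHom_ι : symZeroHom R M (SymmetricAlgebra.ι R M m) = 0 := symHom_ι _ _ _ m

@[simp]
theorem symNegHom_algebraMap :
    symNegHom R M (algebraMap R _ a) = algebraMap R _ a := symHom_algebraMap _ _ _ a

@[simp]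
theorem symNegHom_ι :
    symNegHom R M (SymmetricAlgebra.ι R M m) = -SymmetricAlgebra.ι R M m := symHom_ι _ _ _ m

@[simp]
theorem symLiftHom_incl_algebraMap :
    symLiftHom R M (Tan.incl _ (algebraMap R _ a)) = algebraMap R _ a := by
  simp [symLiftHom]

@[simp]
theorem symLiftHom_incl_ι :
    symLiftHom R M (Tan.incl _ (SymmetricAlgebra.ι R M m)) = 0 := by
  simp [symLiftHom]

@[simp]
theorem symLiftHom_d_algebraMap :
    symLiftHom R M (Tan.d _ (algebraMap R _ a)) = 0 := by
  simp [symLiftHom]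

@[simp]
theorem symLiftHom_d_ι :
    symLiftHom R M (Tan.d _ (SymmetricAlgebra.ι R M m)) = SymmetricAlgebra.ι R M m := by
  simp [symLiftHom, symGen_apply]

theorem symFibreProj_two_algebraMap :
    (fibreProj (symProj R M) 2 1).unop.hom (algebraMap R (SymmetricAlgebra R M) a) =
      (fibreProj (symProj R M) 2 0).unop.hom (algebraMap R (SymmetricAlgebra R M) a) :=
  fibreProj_unop (symProj R M) 2 1 0 a

end

variable {R M}

theorem Tan.sym_hom_ext {S : Type u} [CommRing S] {f g : Tan (SymmetricAlgebra R M) →+* S}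
    (h₁ : ∀ a, f (Tan.incl _ (algebraMap R _ a)) = g (Tan.incl _ (algebraMap R _ a)))
    (h₂ : ∀ m, f (Tan.incl _ (SymmetricAlgebra.ι R M m)) =
      g (Tan.incl _ (SymmetricAlgebra.ι R M m)))
    (h₃ : ∀ a, f (Tan.d _ (algebraMap R _ a)) = g (Tan.d _ (algebraMap R _ a)))
    (h₄ : ∀ m, f (Tan.d _ (SymmetricAlgebra.ι R M m)) =
      g (Tan.d _ (SymmetricAlgebra.ι R M m))) : f = g := by
  have key : toDual (f.comp (incl _)) (f.toAddMonoidHom.comp (d _)) (fun a b => by simp [d_mul]) =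
      toDual (g.comp (incl _)) (g.toAddMonoidHom.comp (d _)) (fun a b => by simp [d_mul]) :=
    symHom_ext (fun a => TrivSqZeroExt.ext (by simpa using h₁ a) (by simpa using h₃ a))
      (fun a => TrivSqZeroExt.ext (by simpa using h₂ a) (by simpa using h₄ a))
  exact hom_ext (fun x => by simpa using congrArg TrivSqZeroExt.fst (RingHom.congr_fun key x))
    (fun x => by simpa using congrArg TrivSqZeroExt.snd (RingHom.congr_fun key x))

theorem Tan.sym_hom_ext₂ {S : Type u} [CommRing S]
    {f g : Tan (Tan (SymmetricAlgebra R M)) →+* S}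
    (h₁ : ∀ a, f (Tan.incl _ (Tan.incl _ (algebraMap R _ a))) =
      g (Tan.incl _ (Tan.incl _ (algebraMap R _ a))))
    (h₂ : ∀ m, f (Tan.incl _ (Tan.incl _ (SymmetricAlgebra.ι R M m))) =
      g (Tan.incl _ (Tan.incl _ (SymmetricAlgebra.ι R M m))))
    (h₃ : ∀ a, f (Tan.incl _ (Tan.d _ (algebraMap R _ a))) =
      g (Tan.incl _ (Tan.d _ (algebraMap R _ a))))
    (h₄ : ∀ m, f (Tan.incl _ (Tan.d _ (SymmetricAlgebra.ι R M m))) =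
      g (Tan.incl _ (Tan.d _ (SymmetricAlgebra.ι R M m))))
    (h₅ : ∀ a, f (Tan.d _ (Tan.incl _ (algebraMap R _ a))) =
      g (Tan.d _ (Tan.incl _ (algebraMap R _ a))))
    (h₆ : ∀ m, f (Tan.d _ (Tan.incl _ (SymmetricAlgebra.ι R M m))) =
      g (Tan.d _ (Tan.incl _ (SymmetricAlgebra.ι R M m))))
    (h₇ : ∀ a, f (Tan.d _ (Tan.d _ (algebraMap R _ a))) =
      g (Tan.d _ (Tan.d _ (algebraMap R _ a))))
    (h₈ : ∀ m, f (Tan.d _ (Tan.d _ (SymmetricAlgebra.ι R M m))) =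
      g (Tan.d _ (Tan.d _ (SymmetricAlgebra.ι R M m)))) : f = g := by
  have key : toDual (f.comp (incl _)) (f.toAddMonoidHom.comp (d _)) (fun a b => by simp [d_mul]) =
      toDual (g.comp (incl _)) (g.toAddMonoidHom.comp (d _)) (fun a b => by simp [d_mul]) :=
    sym_hom_ext (fun a => TrivSqZeroExt.ext (by simpa using h₁ a) (by simpa using h₅ a))
      (fun a => TrivSqZeroExt.ext (by simpa using h₂ a) (by simpa using h₆ a))
      (fun a => TrivSqZeroExt.ext (by simpa using h₃ a) (by simpa using h₇ a))
      (fun a => TrivSqZeroExt.ext (by simpa using h₄ a) (by simpa using h₈ a))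
  exact hom_ext (fun x => by simpa using congrArg TrivSqZeroExt.fst (RingHom.congr_fun key x))
    (fun x => by simpa using congrArg TrivSqZeroExt.snd (RingHom.congr_fun key x))

variable (R M)

theorem symAdditive : IsAdditiveBundle (symProj R M) (CommRingCat.ofHom (symAddHom R M)).op
    (CommRingCat.ofHom (symZeroHom R M)).op where
  sum_proj j := match j with
    | 0 => opHom_ext (RingHom.ext fun a => by simp)
    | 1 => opHom_ext (RingHom.ext fun a => by simp [symFibreProj_two_algebraMap R M])
  zero_proj := opHom_ext (RingHom.ext fun a => by simp)
  assoc := by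
    refine opHom_ext (symHom_ext ?_ ?_) <;> intro a <;>
      simp [fibrePair_unop_zero (symProj R M), fibrePair_unop_one (symProj R M), add_assoc]
  zero_add := by
    refine opHom_ext (symHom_ext ?_ ?_) <;> intro a <;>
      simp [fibrePair_unop_zero (symProj R M), fibrePair_unop_one (symProj R M)]
  add_zero := by
    refine opHom_ext (symHom_ext ?_ ?_) <;> intro a <;>
      simp [fibrePair_unop_zero (symProj R M), fibrePair_unop_one (symProj R M)]
  comm := by
    refine opHom_ext (symHom_ext ?_ ?_) <;> intro a <;>
      simp [fibrePair_unop_zero (symProj R M), fibrePair_unop_one (symProj R M),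
        symFibreProj_two_algebraMap R M, add_comm]

variable {M} in
/-- `Sym(f) : Sym_R(M) → Sym_R(N)`, `a ↦ a`, `m ↦ f(m)`. -/
def symMap {N : Type u} [AddCommGroup N] [Module R N] (f : M →ₗ[R] N) :
    SymmetricAlgebra R M →+* SymmetricAlgebra R N :=
  symHom (algebraMap R (SymmetricAlgebra R N)) ((symGen R N).comp f.toAddMonoidHom)
    (by intro a m; simp [symGen_smul])

section
variable {M} {N : Type u} [AddCommGroup N] [Module R N] (f : M →ₗ[R] N)

@[simp]
theorem symMap_algebraMap (a : R) : symMap R f (algebraMap R _ a) = algebraMap R _ a :=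
  symHom_algebraMap _ _ _ a

@[simp]
theorem symMap_ι (m : M) :
    symMap R f (SymmetricAlgebra.ι R M m) = SymmetricAlgebra.ι R N (f m) :=
  symHom_ι _ _ _ m

end

/-- The differential bundle `M_R(M)` over `R`, with total space `Sym_R(M)`. -/
def symBundle : DiffBundleNeg affineTangent.{u}.toTangentStructure (op R) where
  E := op (CommRingCat.of (SymmetricAlgebra R M))
  q := symProj R M
  hasPowers := inferInstance
  preservesPowers := inferInstance
  σ := (CommRingCat.ofHom (symAddHom R M)).op
  z := (CommRingCat.ofHom (symZeroHom R M)).op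
  lam := (CommRingCat.ofHom (symLiftHom R M)).op
  additive := symAdditive R M
  lam_map_proj := by
    refine opHom_ext (Tan.hom_ext ?_ ?_) <;> intro a <;> simp
  lam_map_add := by
    refine opHom_ext (Tan.sym_hom_ext ?_ ?_ ?_ ?_) <;> intro a <;>
      simp [mapFibrePair_unop_zero_incl (symProj R M), mapFibrePair_unop_zero_d (symProj R M),
        mapFibrePair_unop_one_incl (symProj R M), mapFibrePair_unop_one_d (symProj R M)]
  lam_map_zero := by
    refine opHom_ext (Tan.sym_hom_ext ?_ ?_ ?_ ?_) <;> intro a <;> simp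
  lam_proj := by
    refine opHom_ext (symHom_ext ?_ ?_) <;> intro a <;> simp
  lam_add := by
    refine opHom_ext (Tan.sym_hom_ext ?_ ?_ ?_ ?_) <;> intro a <;>
      simp [fibrePair_unop_zero (affineProjAt (op (CommRingCat.of (SymmetricAlgebra R M)))),
        fibrePair_unop_one (affineProjAt (op (CommRingCat.of (SymmetricAlgebra R M)))),
        affineAddHom_incl (op (CommRingCat.of (SymmetricAlgebra R M))),
        affineAddHom_d (op (CommRingCat.of (SymmetricAlgebra R M)))]
  lam_zero := by
    refine opHom_ext (Tan.sym_hom_ext ?_ ?_ ?_ ?_) <;> intro a <;> simp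
  lam_lam := by
    refine opHom_ext (Tan.sym_hom_ext₂ ?_ ?_ ?_ ?_ ?_ ?_ ?_ ?_) <;> intro a <;> simp
  universal n := by
    refine IsPullback.map (iterFunctor affineT n) (isPullback_op ?_ ?_ ?_)
    · refine opHom_ext (Tan.hom_ext ?_ ?_) <;> intro a <;>
        simp [mapFibrePair_unop_zero_incl (symProj R M), mapFibrePair_unop_zero_d (symProj R M),
          mapFibrePair_unop_one_incl (symProj R M), mapFibrePair_unop_one_d (symProj R M)]
    · intro S a b h
      have hi : ∀ x, a (Tan.incl _ (algebraMap R (SymmetricAlgebra R M) x)) = b x := fun x => by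
        simpa using h (Tan.incl R x)
      have hd : ∀ x, a (Tan.d _ (algebraMap R (SymmetricAlgebra R M) x)) = 0 := fun x => by
        simpa using h (Tan.d R x)
      let f₀ : SymmetricAlgebra R M →+* S := symHom b
        (a.toAddMonoidHom.comp ((Tan.d (SymmetricAlgebra R M)).comp (symGen R M)))
        (by intro x y; simp [symGen_smul, Tan.d_mul, hi, hd])
      let f₁ : SymmetricAlgebra R M →+* S := symHom b
        (a.toAddMonoidHom.comp ((Tan.incl (SymmetricAlgebra R M)).toAddMonoidHom.comp
          (symGen R M)))
        (by intro x y; simp [symGen_smul, hi])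
      let g₀ : op (CommRingCat.of S) ⟶ op (CommRingCat.of (SymmetricAlgebra R M)) :=
        (CommRingCat.ofHom f₀).op
      let g₁ : op (CommRingCat.of S) ⟶ op (CommRingCat.of (SymmetricAlgebra R M)) :=
        (CommRingCat.ofHom f₁).op
      have hg : g₀ ≫ symProj R M = g₁ ≫ symProj R M :=
        opHom_ext (RingHom.ext fun x => by simp [g₀, g₁, f₀, f₁])
      have h₀ : ∀ x, (fibrePair (symProj R M) g₀ g₁ hg).unop.hom
          ((fibreProj (symProj R M) 2 0).unop.hom x) = f₀ x :=
        fibrePair_unop_zero (symProj R M) g₀ g₁ hg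
      have h₁ : ∀ x, (fibrePair (symProj R M) g₀ g₁ hg).unop.hom
          ((fibreProj (symProj R M) 2 1).unop.hom x) = f₁ x :=
        fibrePair_unop_one (symProj R M) g₀ g₁ hg
      refine ⟨(fibrePair (symProj R M) g₀ g₁ hg).unop.hom, ?_, ?_⟩
      · refine RingHom.congr_fun
          (f := RingHom.comp (fibrePair (symProj R M) g₀ g₁ hg).unop.hom _)
          (Tan.sym_hom_ext ?_ ?_ ?_ ?_) <;> intro x <;>
        simp [mapFibrePair_unop_zero_incl (symProj R M), mapFibrePair_unop_zero_d (symProj R M),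
          mapFibrePair_unop_one_incl (symProj R M), mapFibrePair_unop_one_d (symProj R M), h₀, h₁, hi, hd, f₀, f₁, symGen_apply]
      · intro y
        simp [h₀, f₀]
    · intro S c c' h₁ h₂
      have e₀ : ∀ x, c ((fibreProj (symProj R M) 2 0).unop.hom (algebraMap R _ x)) =
          c' ((fibreProj (symProj R M) 2 0).unop.hom (algebraMap R _ x)) := h₂
      have e₁ : ∀ x, c ((fibreProj (symProj R M) 2 1).unop.hom (algebraMap R _ x)) =
          c' ((fibreProj (symProj R M) 2 1).unop.hom (algebraMap R _ x)) := fun x => by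
        simpa [symFibreProj_two_algebraMap R M] using e₀ x
      have e₂ : ∀ x, c ((fibreProj (symProj R M) 2 0).unop.hom (SymmetricAlgebra.ι R M x)) =
          c' ((fibreProj (symProj R M) 2 0).unop.hom (SymmetricAlgebra.ι R M x)) := fun x => by
        simpa [mapFibrePair_unop_zero_incl (symProj R M), mapFibrePair_unop_zero_d (symProj R M),
          mapFibrePair_unop_one_incl (symProj R M), mapFibrePair_unop_one_d (symProj R M)] using h₁ (Tan.d _ (SymmetricAlgebra.ι R M x))
      have e₃ : ∀ x, c ((fibreProj (symProj R M) 2 1).unop.hom (SymmetricAlgebra.ι R M x)) =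
          c' ((fibreProj (symProj R M) 2 1).unop.hom (SymmetricAlgebra.ι R M x)) := fun x => by
        simpa [mapFibrePair_unop_zero_incl (symProj R M), mapFibrePair_unop_zero_d (symProj R M),
          mapFibrePair_unop_one_incl (symProj R M), mapFibrePair_unop_one_d (symProj R M)] using h₁ (Tan.incl _ (SymmetricAlgebra.ι R M x))
      exact fibrePower_ringHom_ext (symProj R M) (symHom_ext e₀ e₂) (symHom_ext e₁ e₃)
  ι := (CommRingCat.ofHom (symNegHom R M)).op
  negative := 
    { neg_proj := opHom_ext (RingHom.ext fun a => by simp)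
      add_neg := by
        refine opHom_ext (symHom_ext ?_ ?_) <;> intro a <;>
          simp [fibrePair_unop_zero (symProj R M), fibrePair_unop_one (symProj R M)]
      neg_add := by
        refine opHom_ext (symHom_ext ?_ ?_) <;> intro a <;>
          simp [fibrePair_unop_zero (symProj R M), fibrePair_unop_one (symProj R M)] }

end

section
variable (R : CommRingCat.{u})

theorem symMap_comp {M N P : Type u} [AddCommGroup M] [Module R M] [AddCommGroup N] [Module R N]
    [AddCommGroup P] [Module R P] (f : M →ₗ[R] N) (g : N →ₗ[R] P) :
    symMap R (g.comp f) = (symMap R g).comp (symMap R f) :=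
  symHom_ext (by intro a; simp) (by intro a; simp)

theorem symMap_id (M : Type u) [AddCommGroup M] [Module R M] :
    symMap R (LinearMap.id : M →ₗ[R] M) = RingHom.id _ :=
  symHom_ext (by intro a; simp) (by intro a; simp)

theorem symMap_comp_symLiftHom {M N : Type u} [AddCommGroup M] [Module R M] [AddCommGroup N]
    [Module R N] (f : M →ₗ[R] N) :
    (symMap R f).comp (symLiftHom R M) = (symLiftHom R N).comp (Tan.map (symMap R f)) :=
  Tan.sym_hom_ext (by intro a; simp) (by intro a; simp) (by intro a; simp) (by intro a; simp)

/-- The functor `M_R` sending a module `M` to the differential bundle `Sym_R(M)`. -/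
def moduleToBundle :
    (ModuleCat.{u} R)ᵒᵖ ⥤ DiffBundleNeg affineTangent.{u}.toTangentStructure (op R) where
  obj M := symBundle R M.unop
  map {M N} f := show DiffBundleHom (symBundle R M.unop).toDiffBundle
      (symBundle R N.unop).toDiffBundle from
    { hom := (CommRingCat.ofHom (symMap R f.unop.hom)).op
      proj := opHom_ext (RingHom.ext (symMap_algebraMap R f.unop.hom))
      lam := opHom_ext (symMap_comp_symLiftHom R f.unop.hom) }
  map_id M := DiffBundleHom.ext (opHom_ext (symMap_id R M.unop))
  map_comp f g := DiffBundleHom.ext (opHom_ext (symMap_comp R _ _))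

end

theorem unop_hom_lam_map_proj {E A : CommRingCat.{u}ᵒᵖ} (q : E ⟶ A) (lam : E ⟶ affineT.obj E)
    (h : lam ≫ affineT.map q = q ≫ affineZero.app A) :
    lam.unop.hom.comp (Tan.map q.unop.hom) = q.unop.hom.comp (Tan.zero A.unop) :=
  congrArg (fun f => f.unop.hom) h

theorem unop_hom_lam_comp {E E' : CommRingCat.{u}ᵒᵖ} (f : E ⟶ E') (lam : E ⟶ affineT.obj E)
    (lam' : E' ⟶ affineT.obj E') (h : f ≫ lam' = lam ≫ affineT.map f) :
    f.unop.hom.comp lam'.unop.hom = lam.unop.hom.comp (Tan.map f.unop.hom) :=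
  congrArg (fun f => f.unop.hom) h

/-- The ring of functions on the total space of a differential bundle over `R`, regarded as an
`R`-algebra via the projection. -/
def TotalRing {R : CommRingCat.{u}}
    (X : DiffBundle affineTangent.{u}.toTangentStructure (op R)) : Type u := X.E.unop

section
variable {R : CommRingCat.{u}}

instance (X : DiffBundle affineTangent.{u}.toTangentStructure (op R)) : CommRing (TotalRing X) :=
  X.E.unop.commRing

instance (X : DiffBundle affineTangent.{u}.toTangentStructure (op R)) :
    Algebra R (TotalRing X) :=
  (show R →+* TotalRing X from X.q.unop.hom).toAlgebra

/-- The lift, as a ring homomorphism `λ : T(E) → E`. -/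
def liftRingHom (X : DiffBundle affineTangent.{u}.toTangentStructure (op R)) :
    Tan (TotalRing X) →+* TotalRing X := X.lam.unop.hom

theorem liftRingHom_comp_map (X : DiffBundle affineTangent.{u}.toTangentStructure (op R)) :
    (liftRingHom X).comp (Tan.map (algebraMap R (TotalRing X))) =
      (algebraMap R (TotalRing X)).comp (Tan.zero R) :=
  unop_hom_lam_map_proj X.q X.lam X.lam_map_proj

theorem liftRingHom_incl_algebraMap
    (X : DiffBundle affineTangent.{u}.toTangentStructure (op R)) (a : R) :
    liftRingHom X (Tan.incl _ (algebraMap R _ a)) = algebraMap R _ a := by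
  simpa using RingHom.congr_fun (liftRingHom_comp_map X) (Tan.incl R a)

theorem liftRingHom_d_algebraMap
    (X : DiffBundle affineTangent.{u}.toTangentStructure (op R)) (a : R) :
    liftRingHom X (Tan.d _ (algebraMap R _ a)) = 0 := by
  simpa using RingHom.congr_fun (liftRingHom_comp_map X) (Tan.d R a)

/-- The map `D_λ : E → E`, `D_λ(x) = λ(d(x))`. -/
def bundleDerivation (X : DiffBundle affineTangent.{u}.toTangentStructure (op R)) :
    TotalRing X →ₗ[R] TotalRing X where
  toFun x := liftRingHom X (Tan.d (TotalRing X) x)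
  map_add' x y := by simp
  map_smul' a x := by
    rw [Algebra.smul_def, Tan.d_mul, map_add, map_mul, map_mul, liftRingHom_incl_algebraMap,
      liftRingHom_d_algebraMap, mul_zero, add_zero, RingHom.id_apply, Algebra.smul_def]

/-- A differential bundle morphism over `R`, as a ring homomorphism `f : E' → E`. -/
def totalRingHom {X Y : DiffBundle affineTangent.{u}.toTangentStructure (op R)}
    (f : DiffBundleHom X Y) : TotalRing Y →+* TotalRing X := f.hom.unop.hom

theorem totalRingHom_comp_algebraMap
    {X Y : DiffBundle affineTangent.{u}.toTangentStructure (op R)} (f : DiffBundleHom X Y) :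
    (totalRingHom f).comp (algebraMap R (TotalRing Y)) = algebraMap R (TotalRing X) :=
  congrArg (fun g => g.unop.hom) f.proj

theorem totalRingHom_comp_liftRingHom
    {X Y : DiffBundle affineTangent.{u}.toTangentStructure (op R)} (f : DiffBundleHom X Y) :
    (totalRingHom f).comp (liftRingHom Y) = (liftRingHom X).comp (Tan.map (totalRingHom f)) :=
  unop_hom_lam_comp f.hom X.lam Y.lam f.lam

/-- A differential bundle morphism over `R`, as an `R`-algebra homomorphism `f : E' → E`. -/
def totalRingMap {X Y : DiffBundle affineTangent.{u}.toTangentStructure (op R)}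
    (f : DiffBundleHom X Y) : TotalRing Y →ₐ[R] TotalRing X :=
  { totalRingHom f with commutes' := RingHom.congr_fun (totalRingHom_comp_algebraMap f) }

theorem totalRingMap_bundleDerivation
    {X Y : DiffBundle affineTangent.{u}.toTangentStructure (op R)} (f : DiffBundleHom X Y)
    (x : TotalRing Y) :
    totalRingMap f (bundleDerivation Y x) = bundleDerivation X (totalRingMap f x) :=
  (RingHom.congr_fun (totalRingHom_comp_liftRingHom f) (Tan.d _ x)).trans
    (congrArg (liftRingHom X) (Tan.map_d (totalRingHom f) x))

/-- The map `im(D_λ') → im(D_λ)`, `D_λ'(x) ↦ D_λ(f(x))`, induced by a morphism `f`. -/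
def rangeMap {X Y : DiffBundle affineTangent.{u}.toTangentStructure (op R)}
    (f : DiffBundleHom X Y) :
    LinearMap.range (bundleDerivation Y) →ₗ[R] LinearMap.range (bundleDerivation X) :=
  (totalRingMap f).toLinearMap.restrict (by
    rintro _ ⟨x, rfl⟩
    exact ⟨totalRingMap f x, (totalRingMap_bundleDerivation f x).symm⟩)

theorem rangeMap_bundleDerivation
    {X Y : DiffBundle affineTangent.{u}.toTangentStructure (op R)} (f : DiffBundleHom X Y)
    (x : TotalRing Y) :
    rangeMap f ⟨bundleDerivation Y x, x, rfl⟩ =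
      ⟨bundleDerivation X (totalRingMap f x), totalRingMap f x, rfl⟩ :=
  Subtype.ext (totalRingMap_bundleDerivation f x)

variable (R)

/-- The functor `M°_R` sending a differential bundle to the image of `D_λ`. As a submodule of the
`R`-algebra `E`, it has the action `a · D_λ(x) = q(a) D_λ(x) = D_λ(q(a) x)`. -/
def bundleToModule :
    DiffBundleNeg affineTangent.{u}.toTangentStructure (op R) ⥤ (ModuleCat.{u} R)ᵒᵖ where
  obj X := op (ModuleCat.of R (LinearMap.range (bundleDerivation X.toDiffBundle)))
  map {X Y} f := (ModuleCat.ofHom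
    (rangeMap (show DiffBundleHom X.toDiffBundle Y.toDiffBundle from f))).op
  map_id _ := rfl
  map_comp _ _ := rfl

end

end

/-!
Dually to a bundle `X` over `R` with total ring `E`, the lift `λ : T(E) → E` amounts to the map
`D = D_λ : E → E`, `x ↦ λ(d x)`. This is an idempotent derivation over `R` along `q ∘ z`, where
`z : E → R` and `q : R → E` are the ring homomorphisms of the zero section and the projection.

Universality of the lift identifies pairs `(u, v)` of points of a fibre with vertical tangent
vectors `μ(u, v)`. Such a vector is based at `v` (`DiffBundle.mu_proj`), and `μ(u, 0) = λ(u)`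
(`DiffBundle.fibrePair_zero_mu`). Hence in any tangent category `λ` identifies the total space with
the vertical tangent vectors based on the zero section (`DiffBundle.hom_ext`,
`DiffBundle.exists_lift`). For commutative rings this is a universal property of `E`: homomorphisms
`f : E → S` correspond, through `f ↦ (f ∘ q, f ∘ D)`, to pairs of a homomorphism `b : R → S` and a
derivation `E → S` over `R` along `b ∘ z` (`totalRing_hom_ext`, `exists_totalRing_hom`).

The universal property makes the canonical map `Sym_R(im D) → E` an isomorphism
(`exists_symToTotal_inverse`), which respects the lifts because `D ∘ D = D` and `z ∘ D = 0`. So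
every differential bundle is naturally isomorphic to `symBundle R (im D)` (`symBundleIso`).
Conversely the image of `D` on `Sym_R(M)` is the module `M` of generators (`range_symInclusion`).

Morphisms of differential bundles involve neither the sum nor the negative, and `symBundle` has a
negative, so the isomorphism `symBundleIso`, which requires no negative on `X`, also shows that
forgetting the negative is an equivalence.
-/

noncomputable section

/-! ### Universality of the lift -/

namespace DiffBundle

variable {C : Type u} [Category.{v} C] {𝕋 : TangentStructure C} {A : C} (X : DiffBundle 𝕋 A)

theorem fibreProj_lam_comp_map_proj :
    (fibreProj X.q 2 0 ≫ X.lam) ≫ 𝕋.T.map X.q =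
      (fibreProj X.q 2 1 ≫ 𝕋.zero.app X.E) ≫ 𝕋.T.map X.q := by
  have h := 𝕋.zero.naturality X.q
  dsimp only [Functor.id_map, Functor.id_obj] at h
  rw [Category.assoc, Category.assoc, X.lam_map_proj, ← h, ← Category.assoc,
    fibreProj_comp X.q 2 0 1, Category.assoc]

/-- The map `μ = T(σ)⟨λπ₁, 0π₂⟩ : E₂ ⟶ T(E)`. -/
def mu : fibrePower X.q 2 ⟶ 𝕋.T.obj X.E :=
  mapFibrePair 𝕋.T X.q (fibreProj X.q 2 0 ≫ X.lam) (fibreProj X.q 2 1 ≫ 𝕋.zero.app X.E)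
    X.fibreProj_lam_comp_map_proj ≫ 𝕋.T.map X.σ

theorem isPullback_mu :
    IsPullback X.mu (fibreProj X.q 2 0 ≫ X.q) (𝕋.T.map X.q) (𝕋.zero.app A) :=
  X.universal 0

theorem comp_proj_zero_proj {Y : C} (f : Y ⟶ X.E) : f ≫ X.q = (f ≫ X.q ≫ X.z) ≫ X.q := by
  simp [X.additive.zero_proj]

/-- Restricted to pairs `⟨f, 0⟩`, the map `μ` is the lift: `μ⟨f, z q f⟩ = λ f`. -/
theorem fibrePair_zero_mu {Y : C} (f : Y ⟶ X.E) :
    fibrePair X.q f (f ≫ X.q ≫ X.z) (X.comp_proj_zero_proj f) ≫ X.mu = f ≫ X.lam := by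
  have hz : X.z ≫ 𝕋.zero.app X.E = 𝕋.zero.app A ≫ 𝕋.T.map X.z := 𝕋.zero.naturality X.z
  -- `⟨λ f, 0 z q f⟩ = T⟨1, z q⟩ λ f`; applying `T(σ)` then cancels the zero summand.
  have key : fibrePair X.q f (f ≫ X.q ≫ X.z) (X.comp_proj_zero_proj f) ≫
      mapFibrePair 𝕋.T X.q (fibreProj X.q 2 0 ≫ X.lam) (fibreProj X.q 2 1 ≫ 𝕋.zero.app X.E)
        X.fibreProj_lam_comp_map_proj =
      f ≫ X.lam ≫ 𝕋.T.map (fibrePair X.q (𝟙 X.E) (X.q ≫ X.z)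
        (by rw [Category.assoc, X.additive.zero_proj, Category.comp_id, Category.id_comp])) := by
    apply (map_fibrePower_isPullback 𝕋.T X.q).hom_ext
    · simp only [Category.assoc, mapFibrePair_proj_zero, ← 𝕋.T.map_comp, fibrePair_proj_zero,
        𝕋.T.map_id, Category.comp_id]
      rw [← Category.assoc, fibrePair_proj_zero]
    · simp only [Category.assoc, mapFibrePair_proj_one, ← 𝕋.T.map_comp, fibrePair_proj_one]
      rw [← Category.assoc, fibrePair_proj_one, 𝕋.T.map_comp, reassoc_of% X.lam_map_proj, ← hz]
      simp only [Category.assoc]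
  rw [mu, ← Category.assoc, key, Category.assoc, Category.assoc, ← 𝕋.T.map_comp,
    X.additive.add_zero, 𝕋.T.map_id, Category.comp_id]

/-- The tangent vector `μ(u, v)` is based at `v`. -/
theorem mu_proj : X.mu ≫ 𝕋.p.app X.E = fibreProj X.q 2 1 := by
  have hp : 𝕋.T.map X.σ ≫ 𝕋.p.app X.E = 𝕋.p.app (fibrePower X.q 2) ≫ X.σ := 𝕋.p.naturality X.σ
  have hp' (j : Fin 2) : 𝕋.p.app (fibrePower X.q 2) ≫ fibreProj X.q 2 j =
      𝕋.T.map (fibreProj X.q 2 j) ≫ 𝕋.p.app X.E := (𝕋.p.naturality (fibreProj X.q 2 j)).symm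
  have hl : X.lam ≫ 𝕋.p.app X.E = X.q ≫ X.z := X.lam_proj
  have h0 : 𝕋.zero.app X.E ≫ 𝕋.p.app X.E = 𝟙 X.E := (𝕋.additive X.E).zero_proj
  -- The base point of `⟨λ u, 0 v⟩` is `⟨0, v⟩`, whose sum is `v`.
  have key : mapFibrePair 𝕋.T X.q (fibreProj X.q 2 0 ≫ X.lam)
      (fibreProj X.q 2 1 ≫ 𝕋.zero.app X.E) X.fibreProj_lam_comp_map_proj ≫ 𝕋.p.app _ =
      fibreProj X.q 2 1 ≫ fibrePair X.q (X.q ≫ X.z) (𝟙 X.E)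
        (by rw [Category.assoc, X.additive.zero_proj, Category.comp_id, Category.id_comp]) := by
    apply (fibrePower_isPullback X.q).hom_ext
    · rw [Category.assoc, Category.assoc, hp', fibrePair_proj_zero, ← Category.assoc,
        mapFibrePair_proj_zero, Category.assoc, hl, ← Category.assoc, ← Category.assoc,
        fibreProj_comp X.q 2 0 1]
    · rw [Category.assoc, Category.assoc, hp', fibrePair_proj_one, ← Category.assoc,
        mapFibrePair_proj_one, Category.assoc, h0]
  calc X.mu ≫ 𝕋.p.app X.E = _ ≫ 𝕋.T.map X.σ ≫ 𝕋.p.app X.E := Category.assoc _ _ _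
    _ = _ := by
      rw [hp, ← Category.assoc, key, Category.assoc, X.additive.zero_add, Category.comp_id]

/-- A map into the total space is determined by its composites with `λ` and `q`. -/
theorem hom_ext {Y : C} {f g : Y ⟶ X.E} (hl : f ≫ X.lam = g ≫ X.lam) (hq : f ≫ X.q = g ≫ X.q) :
    f = g := by
  have key : fibrePair X.q f (f ≫ X.q ≫ X.z) (X.comp_proj_zero_proj f) =
      fibrePair X.q g (g ≫ X.q ≫ X.z) (X.comp_proj_zero_proj g) := by
    apply X.isPullback_mu.hom_ext
    · rw [fibrePair_zero_mu, fibrePair_zero_mu, hl]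
    · simp only [← Category.assoc, fibrePair_proj_zero, hq]
  simpa using congrArg (· ≫ fibreProj X.q 2 0) key

/-- The total space consists of the tangent vectors to it that are vertical and based on the
zero section. -/
theorem exists_lift {Y : C} (v : Y ⟶ 𝕋.T.obj X.E) (w : Y ⟶ A)
    (hq : v ≫ 𝕋.T.map X.q = w ≫ 𝕋.zero.app A) (hp : v ≫ 𝕋.p.app X.E = w ≫ X.z) :
    ∃ f : Y ⟶ X.E, f ≫ X.lam = v ∧ f ≫ X.q = w := by
  let c := X.isPullback_mu.lift v w hq
  have hv : c ≫ X.mu = v := X.isPullback_mu.lift_fst _ _ _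
  have hw : c ≫ fibreProj X.q 2 0 ≫ X.q = w := X.isPullback_mu.lift_snd _ _ _
  have h₁ : c ≫ fibreProj X.q 2 1 = w ≫ X.z := by
    rw [← X.mu_proj]
    exact (Category.assoc _ _ _).symm.trans ((congrArg (· ≫ 𝕋.p.app X.E) hv).trans hp)
  refine ⟨c ≫ fibreProj X.q 2 0, ?_, (Category.assoc _ _ _).trans hw⟩
  rw [← fibrePair_zero_mu, ← hv]
  congr 1
  apply (fibrePower_isPullback X.q).hom_ext
  · rw [fibrePair_proj_zero]
  · rw [fibrePair_proj_one, h₁, Category.assoc, reassoc_of% hw]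

end DiffBundle

/-! ### The derivation of a differential bundle -/

section
variable {R : CommRingCat.{u}} (X : DiffBundle affineTangent.{u}.toTangentStructure (op R))

/-- The zero section, as a ring homomorphism `z : E → R`. -/
def zeroRingHom : TotalRing X →+* R := X.z.unop.hom

@[simp]
theorem zeroRingHom_algebraMap (a : R) : zeroRingHom X (algebraMap R (TotalRing X) a) = a :=
  opHom_congr X.additive.zero_proj a

@[simp]
theorem liftRingHom_incl (x : TotalRing X) :
    liftRingHom X (Tan.incl _ x) = algebraMap R (TotalRing X) (zeroRingHom X x) :=
  opHom_congr X.lam_proj x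

theorem liftRingHom_d (x : TotalRing X) :
    liftRingHom X (Tan.d _ x) = bundleDerivation X x := rfl

@[simp]
theorem bundleDerivation_algebraMap (a : R) :
    bundleDerivation X (algebraMap R (TotalRing X) a) = 0 :=
  liftRingHom_d_algebraMap X a

/-- `D_λ` is a derivation along the zero section, because `p λ = z q`. -/
theorem bundleDerivation_mul (x y : TotalRing X) :
    bundleDerivation X (x * y) =
      zeroRingHom X x • bundleDerivation X y + zeroRingHom X y • bundleDerivation X x := by
  rw [← liftRingHom_d, Tan.d_mul, map_add, map_mul, map_mul, liftRingHom_incl, liftRingHom_incl,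
    liftRingHom_d, liftRingHom_d, Algebra.smul_def, Algebra.smul_def]

@[simp]
theorem zeroRingHom_bundleDerivation (x : TotalRing X) :
    zeroRingHom X (bundleDerivation X x) = 0 :=
  (opHom_congr X.lam_zero (Tan.d X.E.unop x)).trans
    ((congrArg X.z.unop.hom (Tan.zero_d X.E.unop x)).trans (map_zero X.z.unop.hom))

/-- The identity `T(λ)λ = ℓλ` says that `D_λ` is idempotent. -/
@[simp]
theorem bundleDerivation_bundleDerivation (x : TotalRing X) :
    bundleDerivation X (bundleDerivation X x) = bundleDerivation X x := by
  have h := opHom_congr X.lam_lam (Tan.d _ (Tan.d X.E.unop x))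
  refine Eq.trans (congrArg (liftRingHom X) (Tan.map_d (liftRingHom X) _).symm) (h.trans ?_)
  exact congrArg (liftRingHom X) (Tan.vlift_d_d _ x)

variable {X}

/-- A homomorphism out of the total ring is determined by its restriction to the base ring and to
the image of `D_λ`. -/
theorem totalRing_hom_ext {S : Type u} [CommRing S] {f g : TotalRing X →+* S}
    (hq : ∀ a, f (algebraMap R (TotalRing X) a) = g (algebraMap R (TotalRing X) a))
    (hD : ∀ x, f (bundleDerivation X x) = g (bundleDerivation X x)) : f = g := by
  let F : op (CommRingCat.of S) ⟶ X.E := (CommRingCat.ofHom f).op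
  let G : op (CommRingCat.of S) ⟶ X.E := (CommRingCat.ofHom g).op
  have h : F = G := by
    apply X.hom_ext
    · exact opHom_ext (Tan.hom_ext (fun x => (congrArg f (liftRingHom_incl X x)).trans
        ((hq _).trans (congrArg g (liftRingHom_incl X x).symm))) hD)
    · exact opHom_ext (RingHom.ext hq)
  exact congrArg (fun k => k.unop.hom) h

/-- Every derivation `Δ` over `R` along the zero section, with values in an `R`-algebra `S`,
factors through `D_λ` by a ring homomorphism: the tangent vector `a ↦ b(z(a))`, `d(a) ↦ Δ(a)` is
vertical and based on the zero section. -/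
theorem exists_totalRing_hom {S : Type u} [CommRing S] (b : R →+* S) (Δ : TotalRing X →+ S)
    (hmul : ∀ x y, Δ (x * y) = b (zeroRingHom X x) * Δ y + b (zeroRingHom X y) * Δ x)
    (hq : ∀ a, Δ (algebraMap R (TotalRing X) a) = 0) :
    ∃ f : TotalRing X →+* S, (∀ a, f (algebraMap R (TotalRing X) a) = b a) ∧
      ∀ x, f (bundleDerivation X x) = Δ x := by
  let v : Tan (TotalRing X) →+* S := Tan.lift (b.comp (zeroRingHom X)) Δ hmul
  have hv₁ : ∀ x, v (Tan.incl _ x) = b (zeroRingHom X x) := Tan.lift_incl _ _ hmul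
  have hv₂ : ∀ x, v (Tan.d _ x) = Δ x := Tan.lift_d _ _ hmul
  let V : op (CommRingCat.of S) ⟶ affineT.obj X.E := (CommRingCat.ofHom v).op
  let W : op (CommRingCat.of S) ⟶ op R := (CommRingCat.ofHom b).op
  obtain ⟨f, hf₁, hf₂⟩ := X.exists_lift V W
    (by
      refine opHom_ext (Tan.hom_ext (fun a => ?_) (fun a => ?_))
      · change v (Tan.map (algebraMap R (TotalRing X)) (Tan.incl R a)) =
          b (Tan.zero R (Tan.incl R a))
        rw [Tan.map_incl, hv₁, zeroRingHom_algebraMap, Tan.zero_incl]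
      · change v (Tan.map (algebraMap R (TotalRing X)) (Tan.d R a)) = b (Tan.zero R (Tan.d R a))
        rw [Tan.map_d, hv₂, hq, Tan.zero_d, map_zero])
    (opHom_ext (RingHom.ext hv₁))
  exact ⟨f.unop.hom, opHom_congr hf₂, fun x => (opHom_congr hf₁ (Tan.d _ x)).trans (hv₂ x)⟩

end

/-! ### The total ring as a symmetric algebra -/

section
variable {R : CommRingCat.{u}} (X : DiffBundle affineTangent.{u}.toTangentStructure (op R))

/-- The module `im(D_λ)`. -/
abbrev derivationRange : Submodule R (TotalRing X) := LinearMap.range (bundleDerivation X)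

/-- The homomorphism `Sym_R(im(D_λ)) → E` extending the inclusion of `im(D_λ)`. -/
def symToTotal : SymmetricAlgebra R (derivationRange X) →+* TotalRing X :=
  (SymmetricAlgebra.lift (derivationRange X).subtype).toRingHom

@[simp]
theorem symToTotal_algebraMap (a : R) :
    symToTotal X (algebraMap R _ a) = algebraMap R (TotalRing X) a :=
  (SymmetricAlgebra.lift (derivationRange X).subtype).commutes a

@[simp]
theorem symToTotal_ι (m : derivationRange X) :
    symToTotal X (SymmetricAlgebra.ι R _ m) = m :=
  SymmetricAlgebra.lift_ι_apply (derivationRange X).subtype m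

/-- The inverse of `Sym_R(im(D_λ)) → E` is the factorization through `D_λ` of the derivation
`E → im(D_λ) ⊆ Sym_R(im(D_λ))` given by `D_λ` itself. -/
theorem exists_symToTotal_inverse : ∃ f : TotalRing X →+* SymmetricAlgebra R (derivationRange X),
    f.comp (symToTotal X) = RingHom.id _ ∧ (symToTotal X).comp f = RingHom.id _ := by
  obtain ⟨f, hf₁, hf₂⟩ := exists_totalRing_hom (X := X)
    (algebraMap R (SymmetricAlgebra R (derivationRange X)))
    ((SymmetricAlgebra.ι R (derivationRange X)).comp
      (bundleDerivation X).rangeRestrict).toAddMonoidHom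
    (fun x y => by
      have h : (bundleDerivation X).rangeRestrict (x * y) =
          zeroRingHom X x • (bundleDerivation X).rangeRestrict y +
            zeroRingHom X y • (bundleDerivation X).rangeRestrict x :=
        Subtype.ext (bundleDerivation_mul X x y)
      change SymmetricAlgebra.ι R _ ((bundleDerivation X).rangeRestrict (x * y)) = _
      rw [h, map_add, map_smul, map_smul, Algebra.smul_def, Algebra.smul_def]
      rfl)
    (fun a => by
      have h : (bundleDerivation X).rangeRestrict (algebraMap R (TotalRing X) a) = 0 :=
        Subtype.ext (bundleDerivation_algebraMap X a)
      exact (congrArg (SymmetricAlgebra.ι R _) h).trans (map_zero _))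
  have hf₂' (x : TotalRing X) : f (bundleDerivation X x) =
      SymmetricAlgebra.ι R _ ((bundleDerivation X).rangeRestrict x) := hf₂ x
  refine ⟨f, symHom_ext (fun a => by simp [hf₁]) ?_,
    totalRing_hom_ext (fun a => by simp [hf₁]) (fun x => by simp [hf₂'])⟩
  rintro ⟨_, x, rfl⟩
  simp only [RingHom.comp_apply, symToTotal_ι, hf₂', RingHom.id_apply]
  rfl

theorem symToTotal_comp_symLiftHom :
    (symToTotal X).comp (symLiftHom R (derivationRange X)) =
      (liftRingHom X).comp (Tan.map (symToTotal X)) := by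
  refine Tan.sym_hom_ext ?_ ?_ ?_ ?_
  · intro a; simp
  · rintro ⟨_, x, rfl⟩; simp
  · intro a; simp [liftRingHom_d]
  · rintro ⟨_, x, rfl⟩; simp [liftRingHom_d]

/-- The comparison morphism `X ⟶ M_R(im(D_λ))`, dual to `symToTotal`. -/
def toSymBundle : X ⟶ (symBundle R (derivationRange X)).toDiffBundle :=
  show DiffBundleHom X (symBundle R (derivationRange X)).toDiffBundle from
  { hom := (CommRingCat.ofHom (symToTotal X)).op
    proj := opHom_ext (RingHom.ext (symToTotal_algebraMap X))
    lam := opHom_ext (symToTotal_comp_symLiftHom X) }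

end

/-- A morphism of differential bundles with invertible underlying map is invertible. -/
theorem DiffBundle.isIso_of_isIso_hom {C : Type u} [Category.{v} C] {𝕋 : TangentStructure C} {A : C}
    {X Y : DiffBundle 𝕋 A} (f : X ⟶ Y) [IsIso (DiffBundleHom.hom f)] : IsIso f := by
  let φ : DiffBundleHom X Y := f
  have : IsIso φ.hom := ‹_›
  let g : DiffBundleHom Y X :=
    { hom := inv φ.hom
      proj := by rw [IsIso.inv_comp_eq, φ.proj]
      lam := by
        rw [IsIso.inv_comp_eq, ← Category.assoc, φ.lam, Category.assoc, ← 𝕋.T.map_comp,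
          IsIso.hom_inv_id, 𝕋.T.map_id, Category.comp_id] }
  exact ⟨g, DiffBundleHom.ext (IsIso.hom_inv_id φ.hom), DiffBundleHom.ext (IsIso.inv_hom_id φ.hom)⟩

section
variable {R : CommRingCat.{u}} (X : DiffBundle affineTangent.{u}.toTangentStructure (op R))

theorem isIso_toSymBundle : IsIso (toSymBundle X) := by
  obtain ⟨f, h₁, h₂⟩ := exists_symToTotal_inverse X
  have : IsIso (DiffBundleHom.hom (toSymBundle X)) :=
    ⟨(CommRingCat.ofHom f).op, opHom_ext h₂, opHom_ext h₁⟩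
  exact DiffBundle.isIso_of_isIso_hom _

/-- The isomorphism `X ≅ M_R(im(D_λ))` given by `toSymBundle`. -/
def symBundleIso : X ≅ (symBundle R (derivationRange X)).toDiffBundle :=
  letI := isIso_toSymBundle X
  asIso (toSymBundle X)

variable {X} in
/-- An injective linear map onto the image of `D_λ`, as an isomorphism of modules. -/
def rangeIso {M : ModuleCat.{u} R} (j : M →ₗ[R] TotalRing X) (hj : Function.Injective j)
    (h : LinearMap.range j = derivationRange X) :
    M ≅ ModuleCat.of R (derivationRange X) :=
  ((LinearEquiv.ofInjective j hj).trans (LinearEquiv.ofEq _ _ h)).toModuleIso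

end

/-! ### Recovering a module from its symmetric algebra -/

/-- The square-zero extension `R ⊕ M` separates the generators of the symmetric algebra. -/
theorem SymmetricAlgebra.ι_injective (R : Type*) (M : Type*) [CommRing R] [AddCommGroup M]
    [Module R M] : Function.Injective (SymmetricAlgebra.ι R M) := by
  let _ : Module Rᵐᵒᵖ M := Module.compHom _ ((RingHom.id R).fromOpposite mul_comm)
  have : IsCentralScalar R M := ⟨fun r m => rfl⟩
  refine Function.LeftInverse.injective
    (g := fun x => (SymmetricAlgebra.lift (TrivSqZeroExt.inrHom R M) x).snd) fun m => ?_
  simp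

section
variable (R : CommRingCat.{u}) (M : Type u) [AddCommGroup M] [Module R M]

@[simp]
theorem bundleDerivation_symBundle_ι (m : M) :
    bundleDerivation (symBundle R M).toDiffBundle (SymmetricAlgebra.ι R M m) =
      SymmetricAlgebra.ι R M m :=
  symLiftHom_d_ι R M m

/-- On `Sym_R(M)`, the Leibniz rule along the zero section confines the values of `D_λ` to the
generators. -/
theorem exists_ι_eq_bundleDerivation (x : SymmetricAlgebra R M) :
    ∃ m, SymmetricAlgebra.ι R M m = bundleDerivation (symBundle R M).toDiffBundle x := by
  induction x using SymmetricAlgebra.induction with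
  | algebraMap r =>
    exact ⟨0, (map_zero _).trans (bundleDerivation_algebraMap (symBundle R M).toDiffBundle r).symm⟩
  | ι m => exact ⟨m, (bundleDerivation_symBundle_ι R M m).symm⟩
  | mul a b ha hb =>
    obtain ⟨m, hm⟩ := ha
    obtain ⟨n, hn⟩ := hb
    refine ⟨zeroRingHom (symBundle R M).toDiffBundle a • n +
      zeroRingHom (symBundle R M).toDiffBundle b • m, ?_⟩
    refine Eq.trans ?_ (bundleDerivation_mul (symBundle R M).toDiffBundle a b).symm
    rw [← hm, ← hn, map_add, map_smul, map_smul]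
    rfl
  | add a b ha hb =>
    obtain ⟨m, hm⟩ := ha
    obtain ⟨n, hn⟩ := hb
    exact ⟨m + n, (map_add _ m n).trans ((congrArg₂ (· + ·) hm hn).trans
      (map_add (bundleDerivation (symBundle R M).toDiffBundle) a b).symm)⟩

/-- The inclusion of `M` in `Sym_R(M)`, regarded as the total ring of `M_R(M)`. -/
def symInclusion : M →ₗ[R] TotalRing (symBundle R M).toDiffBundle where
  toFun := SymmetricAlgebra.ι R M
  map_add' := map_add _
  map_smul' := fun a m => symGen_smul R M a m

theorem symInclusion_injective : Function.Injective (symInclusion R M) :=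
  SymmetricAlgebra.ι_injective R M

theorem range_symInclusion : LinearMap.range (symInclusion R M) =
    derivationRange (symBundle R M).toDiffBundle := by
  refine le_antisymm ?_ ?_
  · rintro _ ⟨m, rfl⟩
    exact ⟨SymmetricAlgebra.ι R M m, bundleDerivation_symBundle_ι R M m⟩
  · rintro _ ⟨x, rfl⟩
    exact exists_ι_eq_bundleDerivation R M x

end

/-! ### The equivalences -/

section
variable (R : CommRingCat.{u})

/-- The isomorphism `M ≅ im(D_λ)` for `Sym_R(M)`, natural in `M`. -/
def unitIso : 𝟭 (ModuleCat.{u} R)ᵒᵖ ≅ moduleToBundle R ⋙ bundleToModule R :=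
  (NatIso.ofComponents (fun M => (rangeIso (symInclusion R M.unop)
    (symInclusion_injective R M.unop) (range_symInclusion R M.unop)).op)
    (by
      intro M N f
      refine Quiver.Hom.unop_inj (ModuleCat.hom_ext (LinearMap.ext fun m => Subtype.ext ?_))
      exact symMap_ι R f.unop.hom m)).symm

/-- Morphisms of differential bundles with negatives are the morphisms of the underlying
differential bundles, so forgetting the negative is fully faithful. -/
def forgetNegative_fullyFaithful {C : Type u} [Category.{v} C] (𝕋 : TangentStructure C) (A : C) :
    (forgetNegative 𝕋 A).FullyFaithful where
  preimage f := f

/-- The isomorphism `X ≅ M_R(im(D_λ))`, natural in `X`. -/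
def counitIso : bundleToModule R ⋙ moduleToBundle R ≅ 𝟭 _ :=
  (NatIso.ofComponents (fun X => (forgetNegative_fullyFaithful _ _).preimageIso
    (symBundleIso X.toDiffBundle)) (by
      intro X Y f
      -- Both sides are ring homomorphisms out of `Sym_R(im(D_λ))` for `Y`.
      let φ : DiffBundleHom X.toDiffBundle Y.toDiffBundle := f
      refine DiffBundleHom.ext (opHom_ext (symHom_ext ?_ ?_))
      · intro a
        refine (congrArg (totalRingHom φ) (symToTotal_algebraMap Y.toDiffBundle a)).trans ?_
        refine (RingHom.congr_fun (totalRingHom_comp_algebraMap φ) a).trans ?_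
        refine (symToTotal_algebraMap X.toDiffBundle a).symm.trans ?_
        exact congrArg (symToTotal X.toDiffBundle) (symMap_algebraMap R (rangeMap φ) a).symm
      · intro m
        refine (congrArg (totalRingHom φ) (symToTotal_ι Y.toDiffBundle m)).trans ?_
        refine (symToTotal_ι X.toDiffBundle (rangeMap φ m)).symm.trans ?_
        exact congrArg (symToTotal X.toDiffBundle) (symMap_ι R (rangeMap φ) m).symm)).symm

end

end

theorem mainTheorem2 (R : CommRingCat.{u}) :
    (∃ e : (ModuleCat.{u} R)ᵒᵖ ≌ DiffBundleNeg affineTangent.{u}.toTangentStructure (op R),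
      e.functor = moduleToBundle R ∧ e.inverse = bundleToModule R) ∧
    (forgetNegative affineTangent.{u}.toTangentStructure (op R)).IsEquivalence := by
  -- `Equivalence.mk` alters only the unit, so the two functors remain as given.
  refine ⟨⟨CategoryTheory.Equivalence.mk _ _ (unitIso R) (counitIso R), rfl, rfl⟩, ?_⟩
  have h := forgetNegative_fullyFaithful affineTangent.{u}.toTangentStructure (op R)
  exact
    { full := h.full
      faithful := h.faithful
      -- `symBundle` carries a negative, and `X` is isomorphic to it whether or not `X` does.
      essSurj := ⟨fun X => ⟨symBundle R (derivationRange X), ⟨(symBundleIso X).symm⟩⟩⟩ }
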